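/- **The Quadratic Concentration Inequality.** For a probability law $F$ on $\mathbb{R}$ write $\kappa_F=\sup_{x\in\mathbb{R}}F(\{x\})$ for its biggest jump, and let $D_F=\{x: F(\{x\})>0\}$ be the set of discontinuities of its distribution function. Let $x_F$ be a point with $F(\{x_F\})=\kappa_F$ and let $\Delta\in(0,1)$. Put $\kappa_{F,\Delta}=\kappa_F$ if $F$ is discrete and $x_F$ is not an accumulation point of $D_F$, and $\kappa_{F,\Delta}=\kappa_F+\Delta$ otherwise; it is always assumed that $\Delta$ is so small that $\kappa_{F,\Delta}<1$ (both $x_F$ and $\Delta$ may depend on $F$). There is a universal constant $C>0$ with the following property. Let $\xi_1,\ldots,\xi_n$ be independent real random variables, none of them almost surely constant, let $(c_{ij})_{1\le i,j\le n}$ be a real array with $c_{ij}=c_{ji}$, and let $S_1\sqcup S_2=\{1,\ldots,n\}$ be a partition with $S_2\neq\emptyset$ such that for each $j\in S_2$ the set $N_j=\{i\in S_1: c_{ij}\neq 0\}$ is non-empty. Let $\kappa(i)$, $\kappa_\Delta(i)$ be the numbers $\kappa_F$, $\kappa_{F,\Delta}$ for the law $F$ of $\xi_i$, and let $\overline{\kappa}(i)$,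 $\overline{\kappa}_\Delta(i)$ be the same numbers for the law of $\xi_i-\xi_i'$, where $\xi_i'$ is an independent copy of $\xi_i$. Then for every $x\in\mathbb{R}$, every such choice of the points $x_F$ and every such choice of the numbers $\Delta$, $$ \Pr\Big\{\sum_{1\le i,j\le n}c_{ij}\xi_i\xi_j=x\Big\}\le C\left[\frac{1}{|S_2|}\sum_{j\in S_2}\frac{\sum_{i\in N_j}(1-\overline{\kappa}(i))\,\overline{\kappa}_\Delta(i)}{\big\{\sum_{i\in N_j}[1-\overline{\kappa}_\Delta(i)]\big\}^{3/2}}+\sup_{D\subset S_2,\ |D|\ge|S_2|/2}\frac{\sum_{j\in D}(1-\kappa(j))\,\kappa_\Delta(j)}{\big\{\sum_{j\in D}[1-\kappa_\Delta(j)]\big\}^{3/2}}\right]^{1/2}. $$ -/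

import Mathlib

open MeasureTheory ProbabilityTheory Filter Topology

/-- A real random variable is non-degenerate if it is not almost surely constant. -/
def IsNondegenerate {Ω : Type*} [MeasurableSpace Ω] (P : Measure Ω) (X : Ω → ℝ) : Prop :=
  ¬ ∃ a : ℝ, ∀ᵐ ω ∂P, X ω = a

/-- The law of `ξ - ξ'`, where `ξ` has law `μ` and `ξ'` is an independent copy of `ξ`. -/
noncomputable def symmetrizedLaw (μ : Measure ℝ) : Measure ℝ :=
  (μ.prod μ).map (fun p : ℝ × ℝ => p.1 - p.2)

/-- The biggest jump `κ = sup_x μ {x}` of the distribution function of `μ`. -/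
noncomputable def biggestJump (μ : Measure ℝ) : ℝ :=
  ⨆ x : ℝ, μ.real {x}

/-- The set `D_F` of discontinuities of the distribution function of `μ`, i.e. its atoms. -/
def jumpSet (μ : Measure ℝ) : Set ℝ :=
  {x | μ {x} ≠ 0}

/-- The distribution `μ` is discrete: it is carried by its (countable) set of atoms. -/
def IsDiscreteLaw (μ : Measure ℝ) : Prop :=
  μ (jumpSet μ)ᶜ = 0

open scoped Classical in
/-- The number `κ_Δ`, for a point `x` at which the biggest jump `κ` is attained and a given `Δ`:
it is `κ` if `μ` is discrete and `x` is not an accumulation point of the set of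
discontinuities, and `κ + Δ` otherwise. -/
noncomputable def jumpLevel (μ : Measure ℝ) (x Δ : ℝ) : ℝ :=
  if IsDiscreteLaw μ ∧ ¬ AccPt x (𝓟 (jumpSet μ)) then biggestJump μ else biggestJump μ + Δ

/-- `k` is an admissible value of `κ_Δ` for the law `μ`: `k = κ_Δ < 1` for some `Δ ∈ (0, 1)` and
some point `x` at which the biggest jump is attained. -/
def IsJumpLevel (μ : Measure ℝ) (k : ℝ) : Prop :=
  k < 1 ∧ ∃ x Δ : ℝ, μ.real {x} = biggestJump μ ∧ 0 < Δ ∧ Δ < 1 ∧ k = jumpLevel μ x Δ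

/-- The linear concentration bound
`∑_{i ∈ s} (1 - κ(i)) κ_Δ(i) / (∑_{i ∈ s} (1 - κ_Δ(i)))^{3/2}`. -/
noncomputable def linearBound {ι : Type*} (s : Finset ι) (κ κΔ : ι → ℝ) : ℝ :=
  (∑ i ∈ s, (1 - κ i) * κΔ i) / (∑ i ∈ s, (1 - κΔ i)) ^ (3 / 2 : ℝ)

/-- The neighbourhood `N_j = {i ∈ S₁ : c_{ij} ≠ 0}`. -/
noncomputable def nbhd {n : ℕ} (c : Fin n → Fin n → ℝ) (S₁ : Finset (Fin n)) (j : Fin n) :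
    Finset (Fin n) :=
  S₁.filter (fun i => c i j ≠ 0)

/-!
Among laws whose atoms are at most `1 / k`, a rearrangement argument shows that the uniform law on
an arithmetic progression of `k` terms makes sums the most concentrated; for `k` a power of two the
coefficients of `(1 + X + ⋯ + X ^ (k - 1)) ^ n` are then estimated through central binomial
coefficients. A law with an atom `κ ≥ 1 / 2` is a mixture of a Dirac mass and of a law with atoms at
most `1 / 2`, the latter having weight `2 (1 - κ)`. Together the two regimes bound the concentration
of a linear form.

For a quadratic form, write `w` for the variables in `S₂` and `z`, `z'` for two independent copies
of those in `S₁`. By the Cauchy–Schwarz inequality the square of the probability is at most the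
probability that both `(z, w)` and `(z', w)` solve the equation, in which case `w` solves the linear
equation with coefficients `2 ∑ i ∈ S₁, c i j (z i - z' i)`. Each coefficient is a linear form in
the symmetrized variables, so by Markov's inequality at least half of them are non-zero except on an
event of small probability, and off this event the linear bound applies once more.
-/

section Rearrangement

lemma sum_range_succ_sum_range_succ_sub {M : Type*} [AddCommMonoid M] (g : ℤ → M) (a : ℤ)
    (m k : ℕ) :
    ∑ i ∈ Finset.range (m + 1), ∑ t ∈ Finset.range (k + 1), g (a + i - t) =
      ∑ i ∈ Finset.range (k + 1 + m), g (a - k + i) +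
        ∑ i ∈ Finset.range m, ∑ t ∈ Finset.range k, g (a + i - t) := by
  have first_row : ∑ t ∈ Finset.range (k + 1), g (a - t) =
      ∑ i ∈ Finset.range (k + 1), g (a - k + i) := by
    rw [← Finset.sum_range_reflect]
    refine Finset.sum_congr rfl fun i hi => ?_
    have := Finset.mem_range.1 hi
    congr 1
    omega
  have later_row : ∀ i ∈ Finset.range m, ∑ t ∈ Finset.range (k + 1), g (a + (i + 1 : ℕ) - t) =
      ∑ t ∈ Finset.range k, g (a + i - t) + g (a - k + (k + 1 + i : ℕ)) := by
    intro i _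
    rw [Finset.sum_range_succ']
    congr 1
    · refine Finset.sum_congr rfl fun t _ => ?_
      congr 1; omega
    · congr 1; omega
  rw [Finset.sum_range_succ', Finset.sum_congr rfl later_row, Finset.sum_add_distrib,
    Finset.sum_range_add (fun i : ℕ => g (a - k + i)), ← first_row]
  simp only [Nat.cast_zero, add_zero]
  abel

/- For `a₀ = min A` and `t₀ = min T` the differences `a₀ - t` (`t ∈ T`) and `x - t₀` (`x ≠ a₀`) are
pairwise distinct, since `a₀ - t ≤ a₀ - t₀ < x - t₀`. -/
lemma exists_sum_eq_sum_sub_add_sum_sub {G M : Type*} [AddCommGroup G] [LinearOrder G]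
    [IsOrderedAddMonoid G] [AddCommMonoid M] (f : G → M) {A T : Finset G} (hA : A.Nonempty)
    (hT : T.Nonempty) :
    ∃ a₀ ∈ A, ∃ t₀ ∈ T, ∃ B : Finset G, B.card + 1 = A.card + T.card ∧
      ∑ x ∈ B, f x = ∑ t ∈ T, f (a₀ - t) + ∑ x ∈ A.erase a₀, f (x - t₀) := by
  set a₀ := A.min' hA
  set t₀ := T.min' hT
  have ha₀ : a₀ ∈ A := A.min'_mem hA
  set B₁ := T.image fun t => a₀ - t
  set B₂ := (A.erase a₀).image fun x => x - t₀
  have hdisj : Disjoint B₁ B₂ := by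
    rw [Finset.disjoint_left]
    intro y hy₁ hy₂
    obtain ⟨t, ht, rfl⟩ := Finset.mem_image.1 hy₁
    obtain ⟨x, hx, hxt⟩ := Finset.mem_image.1 hy₂
    have hlt : a₀ - t < x - t₀ :=
      (sub_le_sub_left (T.min'_le t ht) a₀).trans_lt
        (sub_lt_sub_right (A.min'_lt_of_mem_erase_min' hA hx) t₀)
    exact hlt.ne' hxt
  refine ⟨a₀, ha₀, t₀, T.min'_mem hT, B₁ ∪ B₂, ?_, ?_⟩
  · rw [Finset.card_union_of_disjoint hdisj, Finset.card_image_of_injective _ sub_right_injective,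
      Finset.card_image_of_injective _ sub_left_injective, add_assoc,
      Finset.card_erase_add_one ha₀, add_comm]
  · rw [Finset.sum_union hdisj, Finset.sum_image sub_right_injective.injOn,
      Finset.sum_image sub_left_injective.injOn]

lemma sum_sum_sub_le_sum_range {G M : Type*} [AddCommGroup G] [LinearOrder G]
    [IsOrderedAddMonoid G] [AddCommMonoid M] [PartialOrder M] [IsOrderedAddMonoid M]
    (f : G → M) (g : ℤ → M) (a : ℤ) (A T : Finset G)
    (h : ∀ (B : Finset G) (b : ℤ), 2 * b + B.card = 2 * a + A.card - T.card + 1 →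
      ∑ x ∈ B, f x ≤ ∑ i ∈ Finset.range B.card, g (b + i)) :
    ∑ x ∈ A, ∑ t ∈ T, f (x - t) ≤
      ∑ i ∈ Finset.range A.card, ∑ t ∈ Finset.range T.card, g (a + i - t) := by
  induction hm : A.card generalizing A T with
  | zero => simp [Finset.card_eq_zero.1 hm]
  | succ m ih =>
    rcases hk : T.card with _ | k
    · simp [Finset.card_eq_zero.1 hk]
    obtain ⟨a₀, ha₀, t₀, ht₀, B, hB, sum_B⟩ := exists_sum_eq_sum_sub_add_sum_sub f
      (A := A) (T := T) (Finset.card_pos.1 (by omega)) (Finset.card_pos.1 (by omega))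
    have card_A : (A.erase a₀).card = m := by rw [Finset.card_erase_of_mem ha₀]; omega
    have card_T : (T.erase t₀).card = k := by rw [Finset.card_erase_of_mem ht₀]; omega
    have boundary := h B (a - k) (by omega)
    have remainder := ih (A.erase a₀) (T.erase t₀) (fun B b hb => h B b (by omega)) card_A
    rw [sum_B, show B.card = k + 1 + m by omega] at boundary
    rw [card_T] at remainder
    calc ∑ x ∈ A, ∑ t ∈ T, f (x - t)
        = (∑ t ∈ T, f (a₀ - t) + ∑ x ∈ A.erase a₀, f (x - t₀)) +
            ∑ x ∈ A.erase a₀, ∑ t ∈ T.erase t₀, f (x - t) := by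
          rw [← Finset.add_sum_erase A _ ha₀, add_assoc, ← Finset.sum_add_distrib]
          exact congrArg _ (Finset.sum_congr rfl fun x _ => (Finset.add_sum_erase T _ ht₀).symm)
      _ ≤ _ := by
          rw [sum_range_succ_sum_range_succ_sub]
          exact add_le_add boundary remainder

end Rearrangement

section Atoms

variable {α : Type*}

lemma exists_finset_card_eq_forall_notMem_le [Infinite α] {g : α → ℝ} (h0 : ∀ x, 0 ≤ g x)
    (hg : Tendsto g cofinite (𝓝 0)) (k : ℕ) :
    ∃ T : Finset α, T.card = k ∧ ∀ t ∈ T, ∀ x ∉ T, g x ≤ g t := by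
  classical
  induction k with
  | zero => exact ⟨∅, rfl, by simp⟩
  | succ k ih =>
    obtain ⟨T, hT, htop⟩ := ih
    obtain ⟨y, hyT, hy⟩ : ∃ y ∉ T, ∀ x ∉ T, g x ≤ g y := by
      by_cases! h : ∃ y ∉ T, 0 < g y
      · obtain ⟨y, hyT, hy⟩ := h
        have hfin : {x | g y ≤ g x}.Finite := by
          simpa only [not_lt] using eventually_cofinite.1 (hg.eventually (gt_mem_nhds hy))
        obtain ⟨z, hz, hmax⟩ := Set.exists_max_image {x | g y ≤ g x ∧ x ∉ T} g
          (hfin.subset fun x hx => hx.1) ⟨y, le_rfl, hyT⟩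
        refine ⟨z, hz.2, fun x hx => ?_⟩
        rcases le_total (g y) (g x) with hyx | hxy
        · exact hmax x ⟨hyx, hx⟩
        · exact hxy.trans hz.1
      · obtain ⟨y, hy⟩ := Infinite.exists_notMem_finset T
        exact ⟨y, hy, fun x hx => (h x hx).trans (h0 y)⟩
    refine ⟨insert y T, by simp [hyT, hT], fun t ht x hx => ?_⟩
    rw [Finset.mem_insert, not_or] at hx
    rcases Finset.mem_insert.1 ht with rfl | ht
    · exact hy x hx.2
    · exact htop t ht x hx.2

variable [MeasurableSpace α] [MeasurableSingletonClass α]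

lemma summable_measureReal_singleton (μ : Measure α) [IsFiniteMeasure μ] :
    Summable fun x => μ.real {x} :=
  summable_of_sum_le (fun _ => measureReal_nonneg) fun s => by
    rw [sum_measureReal_singleton]
    exact measureReal_mono (Set.subset_univ _)

lemma exists_integral_le_inv_mul_sum [Infinite α] (μ : Measure α) [IsProbabilityMeasure μ] {k : ℕ}
    (hk : 0 < k) (hμ : ∀ x, μ.real {x} ≤ (k : ℝ)⁻¹) {g : α → ℝ} (h0 : ∀ x, 0 ≤ g x)
    (hg : Tendsto g cofinite (𝓝 0)) (hint : Integrable g μ) :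
    ∃ T : Finset α, T.card = k ∧ ∫ x, g x ∂μ ≤ (k : ℝ)⁻¹ * ∑ t ∈ T, g t := by
  obtain ⟨T, hT, htop⟩ := exists_finset_card_eq_forall_notMem_le h0 hg k
  refine ⟨T, hT, ?_⟩
  obtain ⟨s, hs, hmin⟩ := T.exists_min_image g (Finset.card_pos.1 (by omega))
  have hterm : ∀ t ∈ T, Integrable (({t} : Set α).indicator fun _ => g t - g s) μ := fun t _ =>
    (integrable_const _).indicator (measurableSet_singleton t)
  have hle : ∀ x, g x ≤ g s + ∑ t ∈ T, ({t} : Set α).indicator (fun _ => g t - g s) x := by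
    intro x
    by_cases hx : x ∈ T
    · rw [Finset.sum_eq_single_of_mem x hx fun t _ ht => by simp [ht.symm]]
      simp
    · rw [Finset.sum_eq_zero fun t ht => by simp [ne_of_mem_of_not_mem ht hx |>.symm]]
      simpa using htop s hs x hx
  calc ∫ x, g x ∂μ
      ≤ ∫ x, (g s + ∑ t ∈ T, ({t} : Set α).indicator (fun _ => g t - g s) x) ∂μ :=
        integral_mono hint ((integrable_const _).add (integrable_finsetSum _ hterm)) hle
    _ = g s + ∑ t ∈ T, μ.real {t} * (g t - g s) := by
        rw [integral_add (integrable_const _) (integrable_finsetSum _ hterm),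
          integral_finsetSum _ hterm]
        simp only [integral_indicator_const _ (measurableSet_singleton _), integral_const,
          probReal_univ, smul_eq_mul, one_mul]
    _ ≤ g s + ∑ t ∈ T, (k : ℝ)⁻¹ * (g t - g s) := by
        gcongr with t ht
        · exact sub_nonneg.2 (hmin t ht)
        · exact hμ t
    _ = (k : ℝ)⁻¹ * ∑ t ∈ T, g t := by
        have : (k : ℝ) ≠ 0 := by positivity
        rw [← Finset.mul_sum, Finset.sum_sub_distrib, Finset.sum_const, hT, nsmul_eq_mul]
        field_simp
        ring

end Atoms

section Convolution

lemma measureReal_prod_eq_integral {α β : Type*} [MeasurableSpace α] [MeasurableSpace β]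
    (μ : Measure α) (ν : Measure β) [SFinite μ] [IsFiniteMeasure ν] {s : Set (α × β)}
    (hs : MeasurableSet s) : (μ.prod ν).real s = ∫ x, ν.real (Prod.mk x ⁻¹' s) ∂μ := by
  rw [measureReal_def, Measure.prod_apply hs]
  exact (integral_toReal (measurable_measure_prodMk_left hs).aemeasurable
    (ae_of_all _ fun _ => measure_lt_top _ _)).symm

variable {G : Type*} [AddCommGroup G]

lemma preimage_prodMk_preimage_add_singleton (x y : G) :
    Prod.mk x ⁻¹' ((fun p : G × G => p.1 + p.2) ⁻¹' {y}) = {y - x} := by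
  ext z
  simp only [Set.mem_preimage, Set.mem_singleton_iff, eq_sub_iff_add_eq']

variable [MeasurableSpace G]

/-- The convolution of a list of measures, i.e. the law of a sum of independent variables with
these laws; for the empty list it is the Dirac mass at `0`. -/
noncomputable def convList (L : List (Measure G)) : Measure G :=
  L.foldr (· ∗ ·) (Measure.dirac 0)

lemma convList_nil : convList ([] : List (Measure G)) = Measure.dirac 0 := rfl

lemma convList_cons (μ : Measure G) (L : List (Measure G)) :
    convList (μ :: L) = μ ∗ convList L := rfl

variable [MeasurableAdd₂ G]

lemma isProbabilityMeasure_convList {L : List (Measure G)}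
    (hL : ∀ μ ∈ L, IsProbabilityMeasure μ) : IsProbabilityMeasure (convList L) := by
  induction L with
  | nil => exact Measure.dirac.isProbabilityMeasure
  | cons μ L ih =>
    rw [List.forall_mem_cons] at hL
    have := hL.1
    have := ih hL.2
    rw [convList_cons]
    infer_instance

variable [MeasurableSingletonClass G]

lemma integrable_measureReal_singleton_sub (μ ν : Measure G) [IsFiniteMeasure μ]
    [IsFiniteMeasure ν] (y : G) : Integrable (fun x => ν.real {y - x}) μ := by
  simpa only [preimage_prodMk_preimage_add_singleton] using
    Measure.integrable_measure_prodMk_left (measurable_add (measurableSet_singleton y))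
      (measure_ne_top (μ.prod ν) _)

lemma conv_measureReal_singleton (μ ν : Measure G) [IsFiniteMeasure μ] [IsFiniteMeasure ν]
    (y : G) : (μ ∗ ν).real {y} = ∫ x, ν.real {y - x} ∂μ := by
  rw [Measure.conv, map_measureReal_apply measurable_add (measurableSet_singleton y),
    measureReal_prod_eq_integral μ ν (measurable_add (measurableSet_singleton y))]
  simp only [preimage_prodMk_preimage_add_singleton]

lemma conv_measureReal_finset (μ ν : Measure G) [IsFiniteMeasure μ] [IsFiniteMeasure ν]
    (A : Finset G) : (μ ∗ ν).real A = ∫ x, ∑ a ∈ A, ν.real {a - x} ∂μ := by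
  rw [integral_finsetSum _ fun a _ => integrable_measureReal_singleton_sub μ ν a,
    ← sum_measureReal_singleton]
  exact Finset.sum_congr rfl fun a _ => conv_measureReal_singleton μ ν a

lemma conv_measureReal_singleton_le (μ ν : Measure G) [IsProbabilityMeasure μ]
    [IsFiniteMeasure ν] {M : ℝ} (hM : ∀ x, ν.real {x} ≤ M) (y : G) : (μ ∗ ν).real {y} ≤ M := by
  rw [conv_measureReal_singleton]
  refine (integral_mono (integrable_measureReal_singleton_sub μ ν y) (integrable_const M)
    fun x => hM _).trans_eq ?_
  simp

end Convolution

section StepCount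

/-- The number of ways of writing `y` as an ordered sum of `n` integers from `{0, …, k - 1}`. -/
def stepCount (k : ℕ) : ℕ → ℤ → ℕ
  | 0, y => if y = 0 then 1 else 0
  | n + 1, y => ∑ t ∈ Finset.range k, stepCount k n (y - t)

/- Up to translation, the uniform law on an arithmetic progression of `k` terms is the most
concentrated law with atoms at most `1 / k`. The first factor is replaced by a uniform law on some
`k`-point set, and rearrangement handles the resulting double sum. -/
lemma convList_measureReal_finset_le {G : Type*} [AddCommGroup G] [LinearOrder G]
    [IsOrderedAddMonoid G] [Nontrivial G] [MeasurableSpace G] [MeasurableAdd₂ G]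
    [MeasurableSingletonClass G] {k : ℕ} (hk : 0 < k) (L : List (Measure G))
    (hL : ∀ μ ∈ L, IsProbabilityMeasure μ) (hat : ∀ μ ∈ L, ∀ x, μ.real {x} ≤ (k : ℝ)⁻¹)
    (A : Finset G) (a : ℤ) (ha : 2 * a + A.card = L.length * (k - 1) + 1) :
    (convList L).real A ≤
      (k : ℝ)⁻¹ ^ L.length * ∑ i ∈ Finset.range A.card, (stepCount k L.length (a + i) : ℝ) := by
  induction L generalizing A a with
  | nil =>
    have := isProbabilityMeasure_convList hL
    simp only [List.length_nil, Nat.cast_zero, zero_mul, zero_add, pow_zero, one_mul] at ha ⊢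
    have zero_mem : (-a).toNat ∈ Finset.range A.card := Finset.mem_range.2 (by omega)
    have at_zero : stepCount k 0 (a + (-a).toNat) = 1 := if_pos (by omega)
    have one_le : 1 ≤ ∑ i ∈ Finset.range A.card, (stepCount k 0 (a + i) : ℝ) := by
      simpa only [at_zero, Nat.cast_one] using Finset.single_le_sum
        (f := fun i : ℕ => (stepCount k 0 (a + i) : ℝ)) (fun _ _ => Nat.cast_nonneg _) zero_mem
    exact measureReal_le_one.trans one_le
  | cons μ L ih =>
    rw [List.forall_mem_cons] at hL hat
    have := hL.1
    have := isProbabilityMeasure_convList hL.2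
    obtain ⟨T, hT, integral_le⟩ := exists_integral_le_inv_mul_sum μ hk hat.1
      (g := fun x => ∑ a ∈ A, (convList L).real {a - x})
      (fun x => Finset.sum_nonneg fun _ _ => measureReal_nonneg)
      (by
        simpa using tendsto_finsetSum A fun a _ =>
          (summable_measureReal_singleton (convList L)).tendsto_cofinite_zero.comp
            (sub_right_injective (b := a)).tendsto_cofinite)
      (integrable_finsetSum _ fun a _ => integrable_measureReal_singleton_sub μ _ a)
    have rearrangement := sum_sum_sub_le_sum_range (fun x => (convList L).real {x})
      (fun y => (k : ℝ)⁻¹ ^ L.length * (stepCount k L.length y : ℝ)) a A T fun B b hb => by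
        rw [sum_measureReal_singleton, ← Finset.mul_sum]
        refine ih hL.2 hat.2 B b ?_
        rw [hb, hT, ha, List.length_cons]
        push_cast
        ring
    calc (convList (μ :: L)).real A
        ≤ (k : ℝ)⁻¹ * ∑ t ∈ T, ∑ a ∈ A, (convList L).real {a - t} := by
          rwa [convList_cons, conv_measureReal_finset]
      _ ≤ (k : ℝ)⁻¹ * ∑ i ∈ Finset.range A.card, ∑ t ∈ Finset.range T.card,
            (k : ℝ)⁻¹ ^ L.length * (stepCount k L.length (a + i - t) : ℝ) := by
          rw [Finset.sum_comm]
          gcongr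
      _ = _ := by
          simp only [List.length_cons, stepCount, hT, ← Finset.mul_sum, Nat.cast_sum]
          ring

open Polynomial in
lemma stepCount_eq_coeff (k n : ℕ) (y : ℤ) :
    stepCount k n y =
      if 0 ≤ y then ((∑ i ∈ Finset.range k, (X : ℕ[X]) ^ i) ^ n).coeff y.toNat else 0 := by
  induction n generalizing y with
  | zero =>
    simp only [stepCount, pow_zero, coeff_one]
    split_ifs <;> first | rfl | omega
  | succ n ih =>
    simp only [stepCount, ih]
    rw [pow_succ, Finset.mul_sum, finsetSum_coeff]
    split_ifs with hy
    · refine Finset.sum_congr rfl fun i _ => ?_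
      rw [coeff_mul_X_pow']
      by_cases h : 0 ≤ y - (i : ℤ)
      · rw [if_pos h, if_pos (by omega)]
        congr 1
        omega
      · rw [if_neg h, if_neg (by omega)]
    · exact Finset.sum_eq_zero fun i _ => if_neg (by omega)

lemma sum_antidiagonal_even_choose (n y : ℕ) :
    ∑ p ∈ Finset.HasAntidiagonal.antidiagonal y, (if 2 ∣ p.1 then (n + 1).choose p.2 else 0) =
      ∑ j ∈ Finset.range (y + 1), n.choose j := by
  induction y using Nat.twoStepInduction with
  | zero => simp
  | one => simp [Finset.Nat.antidiagonal_succ, Finset.sum_range_succ, add_comm]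
  | more y ih _ =>
    have even_add_two : ∀ p : ℕ × ℕ, (2 ∣ p.1 + 1 + 1) = (2 ∣ p.1) := fun p => by
      apply propext; omega
    rw [Finset.Nat.sum_antidiagonal_succ, Finset.Nat.sum_antidiagonal_succ]
    simp only [even_add_two]
    rw [ih, Finset.sum_range_succ _ (y + 2), Finset.sum_range_succ _ (y + 1),
      Nat.choose_succ_succ]
    simp only [dvd_zero, if_true, Nat.dvd_one, OfNat.ofNat_ne_one, if_false, zero_add]
    ring

lemma sum_antidiagonal_even_choose_le (n y : ℕ) :
    ∑ p ∈ Finset.HasAntidiagonal.antidiagonal y,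
      (if 2 ∣ p.1 then (n + 1).choose p.2 else 0) ≤ 2 ^ n := by
  rw [sum_antidiagonal_even_choose, ← Nat.sum_range_choose]
  refine Finset.sum_le_sum_of_ne_zero fun j _ hj => ?_
  by_contra h
  exact hj (Nat.choose_eq_zero_of_lt (by simpa using h))

open Polynomial in
lemma geomSum_mul_two_eq_expand_mul {R : Type*} [CommSemiring R] (k : ℕ) :
    ∑ i ∈ Finset.range (k * 2), (X : R[X]) ^ i =
      expand R 2 (∑ i ∈ Finset.range k, (X : R[X]) ^ i) * (1 + X) := by
  simp only [map_sum, map_pow, expand_X]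
  induction k with
  | zero => simp
  | succ k ih =>
    rw [show (k + 1) * 2 = k * 2 + 1 + 1 by ring, Finset.sum_range_succ,
      Finset.sum_range_succ, Finset.sum_range_succ _ k, add_mul, ← ih]
    ring

open Polynomial in
lemma coeff_geomSum_mul_two_pow_le (k n : ℕ) {M : ℕ}
    (hM : ∀ y, ((∑ i ∈ Finset.range k, (X : ℕ[X]) ^ i) ^ (n + 1)).coeff y ≤ M) (y : ℕ) :
    ((∑ i ∈ Finset.range (k * 2), (X : ℕ[X]) ^ i) ^ (n + 1)).coeff y ≤ M * 2 ^ n := by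
  rw [geomSum_mul_two_eq_expand_mul, mul_pow, ← map_pow, coeff_mul]
  refine le_trans ?_ (Nat.mul_le_mul_left M (sum_antidiagonal_even_choose_le n y))
  rw [Finset.mul_sum]
  refine Finset.sum_le_sum fun p _ => ?_
  rw [coeff_expand two_pos, coeff_one_add_X_pow]
  split_ifs
  · exact Nat.mul_le_mul_right _ (hM _)
  · simp

open Polynomial in
lemma coeff_geomSum_two_pow_pow_le (r n y : ℕ) :
    ((∑ i ∈ Finset.range (2 ^ (r + 1)), (X : ℕ[X]) ^ i) ^ (n + 1)).coeff y ≤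
      (n + 1).choose ((n + 1) / 2) * (2 ^ n) ^ r := by
  induction r generalizing y with
  | zero =>
    rw [zero_add, pow_one, pow_zero, mul_one, Finset.sum_range_succ, Finset.sum_range_one,
      pow_zero, pow_one, coeff_one_add_X_pow]
    exact Nat.choose_le_middle y (n + 1)
  | succ r ih =>
    rw [pow_succ 2 (r + 1), pow_succ (2 ^ n) r, ← mul_assoc]
    exact coeff_geomSum_mul_two_pow_le _ n ih y

lemma stepCount_two_pow_le (r n : ℕ) (y : ℤ) :
    stepCount (2 ^ (r + 1)) (n + 1) y ≤ (n + 1).choose ((n + 1) / 2) * (2 ^ n) ^ r := by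
  rw [stepCount_eq_coeff]
  split_ifs
  · exact coeff_geomSum_two_pow_pow_le r n _
  · exact Nat.zero_le _

lemma centralBinom_sq_mul_le (n : ℕ) : n.centralBinom ^ 2 * (2 * n + 1) ≤ 16 ^ n := by
  induction n with
  | zero => simp
  | succ n ih =>
    refine Nat.le_of_mul_le_mul_left (c := (n + 1) ^ 2) ?_ (by positivity)
    calc (n + 1) ^ 2 * ((n + 1).centralBinom ^ 2 * (2 * (n + 1) + 1))
        = ((n + 1) * (n + 1).centralBinom) ^ 2 * (2 * (n + 1) + 1) := by ring
      _ = (n.centralBinom ^ 2 * (2 * n + 1)) * (4 * ((2 * n + 1) * (2 * n + 3))) := by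
          rw [Nat.succ_mul_centralBinom_succ]; ring
      _ ≤ 16 ^ n * (4 * (4 * (n + 1) ^ 2)) := Nat.mul_le_mul ih (by nlinarith)
      _ = (n + 1) ^ 2 * 16 ^ (n + 1) := by ring

lemma choose_half_sq_mul_le (n : ℕ) : n.choose (n / 2) ^ 2 * (n + 1) ≤ 4 ^ n := by
  rcases Nat.even_or_odd' n with ⟨m, rfl | rfl⟩
  · rw [Nat.mul_div_cancel_left m two_pos, pow_mul]
    exact centralBinom_sq_mul_le m
  · have central : (m + 1).centralBinom = 2 * (2 * m + 1).choose m := by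
      rw [Nat.centralBinom_eq_two_mul_choose, show 2 * (m + 1) = 2 * m + 1 + 1 by ring,
        Nat.choose_succ_succ, Nat.choose_symm_half]
      ring
    have bound := centralBinom_sq_mul_le (m + 1)
    have pow_eq : (4 : ℕ) ^ (2 * m + 1) * 4 = 16 ^ (m + 1) := by
      rw [← pow_succ, show 2 * m + 1 + 1 = 2 * (m + 1) by ring, pow_mul]
      norm_num
    rw [central] at bound
    rw [show (2 * m + 1) / 2 = m by omega]
    nlinarith

lemma choose_half_le (n : ℕ) : (n.choose (n / 2) : ℝ) ≤ 2 ^ n / √(n + 1) := by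
  have h : (n.choose (n / 2) : ℝ) ^ 2 * (n + 1) ≤ 4 ^ n := mod_cast choose_half_sq_mul_le n
  rw [le_div_iff₀ (by positivity)]
  refine le_of_sq_le_sq ?_ (by positivity)
  rwa [mul_pow, Real.sq_sqrt (by positivity), ← pow_mul, mul_comm n 2, pow_mul,
    show (2 : ℝ) ^ 2 = 4 by norm_num]

lemma inv_pow_mul_stepCount_le (r : ℕ) {n : ℕ} (hn : n ≠ 0) (y : ℤ) :
    ((2 : ℝ) ^ (r + 1))⁻¹ ^ n * stepCount (2 ^ (r + 1)) n y ≤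
      2 * ((2 : ℝ) ^ (r + 1))⁻¹ / √(n + 1) := by
  obtain ⟨m, rfl⟩ := Nat.exists_eq_succ_of_ne_zero hn
  have count_le : (stepCount (2 ^ (r + 1)) (m + 1) y : ℝ) ≤
      2 ^ (m + 1) / √((m + 1 : ℕ) + 1) * (2 ^ m) ^ r :=
    calc (stepCount (2 ^ (r + 1)) (m + 1) y : ℝ)
        ≤ (m + 1).choose ((m + 1) / 2) * (2 ^ m) ^ r := mod_cast stepCount_two_pow_le r m y
      _ ≤ _ := by gcongr; exact choose_half_le (m + 1)
  have pow_eq : ((2 : ℝ) ^ (r + 1)) ^ (m + 1) = 2 ^ (m + 1) * (2 ^ m) ^ r * 2 ^ r := by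
    simp only [← pow_mul, ← pow_add]
    congr 1
    ring
  refine (mul_le_mul_of_nonneg_left count_le (by positivity)).trans_eq ?_
  rw [Nat.succ_eq_add_one, inv_pow, pow_eq, pow_succ (2 : ℝ) r]
  field_simp

end StepCount

lemma convList_measureReal_singleton_le {G : Type*} [AddCommGroup G] [LinearOrder G]
    [IsOrderedAddMonoid G] [Nontrivial G] [MeasurableSpace G] [MeasurableAdd₂ G]
    [MeasurableSingletonClass G] (r : ℕ) {L : List (Measure G)} (hne : L ≠ [])
    (hL : ∀ μ ∈ L, IsProbabilityMeasure μ)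
    (hat : ∀ μ ∈ L, ∀ x, μ.real {x} ≤ ((2 : ℝ) ^ (r + 1))⁻¹) (x : G) :
    (convList L).real {x} ≤ 4 * ((2 : ℝ) ^ (r + 1))⁻¹ / √(L.length + 1) := by
  have := isProbabilityMeasure_convList hL
  -- The one or two points of `A` are chosen so that `2 * a + #A` has the required parity.
  obtain ⟨A, a, hxA, hA, ha⟩ : ∃ (A : Finset G) (a : ℤ), x ∈ A ∧ A.card ≤ 2 ∧
      2 * a + A.card = L.length * (((2 ^ (r + 1) : ℕ) : ℤ) - 1) + 1 := by
    rcases Int.even_or_odd' ((L.length : ℤ) * (((2 ^ (r + 1) : ℕ) : ℤ) - 1)) with ⟨b, hb | hb⟩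
    · exact ⟨{x}, b, by simp, by simp, by rw [hb]; simp⟩
    · obtain ⟨u, hu⟩ := exists_ne (0 : G)
      refine ⟨{x, x + u}, b, by simp, Finset.card_le_two, ?_⟩
      rw [hb, Finset.card_pair (by simpa using hu)]
      push_cast; ring
  calc (convList L).real {x} ≤ (convList L).real A := measureReal_mono (by simpa using hxA)
    _ ≤ ((2 : ℝ) ^ (r + 1))⁻¹ ^ L.length *
          ∑ i ∈ Finset.range A.card, (stepCount (2 ^ (r + 1)) L.length (a + i) : ℝ) := by
        simpa using convList_measureReal_finset_le (k := 2 ^ (r + 1)) (by positivity) L hL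
          (by simpa using hat) A a ha
    _ ≤ ∑ _i ∈ Finset.range A.card, 2 * ((2 : ℝ) ^ (r + 1))⁻¹ / √(L.length + 1) := by
        rw [Finset.mul_sum]
        exact Finset.sum_le_sum fun i _ =>
          inv_pow_mul_stepCount_le r (List.length_pos_iff.2 hne).ne' _
    _ ≤ 2 * (2 * ((2 : ℝ) ^ (r + 1))⁻¹ / √(L.length + 1)) := by
        rw [Finset.sum_const, Finset.card_range, nsmul_eq_mul]
        gcongr
        exact_mod_cast hA
    _ = _ := by ring


section HalfAtom

variable {α : Type*} [MeasurableSpace α]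

open scoped ENNReal in
/-- The law with mass `1 / 2` at `a`, and otherwise distributed as `μ` conditioned to avoid `a`.
If the mass `κ` of `μ` at `a` is at least `1 / 2`, then `μ` is the mixture of the Dirac mass at `a`
and of this law with weights `2 κ - 1` and `2 (1 - κ)`. -/
noncomputable def halfAtom (μ : Measure α) (a : α) : Measure α :=
  (2⁻¹ : ℝ≥0∞) • Measure.dirac a + (2⁻¹ : ℝ≥0∞) • μ[|{a}ᶜ]

variable [MeasurableSingletonClass α] (μ : Measure α) [IsProbabilityMeasure μ] {a : α}

lemma isProbabilityMeasure_cond_compl_singleton (ha : μ.real {a} < 1) :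
    IsProbabilityMeasure (μ[|{a}ᶜ]) := by
  refine cond_isProbabilityMeasure fun h => ?_
  have := probReal_compl_eq_one_sub (μ := μ) (measurableSet_singleton a)
  rw [measureReal_def, h, ENNReal.toReal_zero] at this
  linarith

lemma isProbabilityMeasure_halfAtom (ha : μ.real {a} < 1) :
    IsProbabilityMeasure (halfAtom μ a) := by
  have := isProbabilityMeasure_cond_compl_singleton μ ha
  refine ⟨?_⟩
  simp only [halfAtom, Measure.add_apply, Measure.smul_apply, measure_univ, smul_eq_mul, mul_one]
  exact ENNReal.inv_two_add_inv_two

lemma halfAtom_measureReal_singleton_le (ha : μ.real {a} < 1) (x : α) :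
    (halfAtom μ a).real {x} ≤ 2⁻¹ := by
  have := isProbabilityMeasure_cond_compl_singleton μ ha
  have eq_add : (halfAtom μ a).real {x} =
      2⁻¹ * (Measure.dirac a).real {x} + 2⁻¹ * (μ[|{a}ᶜ]).real {x} := by
    simp only [halfAtom, measureReal_def, Measure.add_apply, Measure.smul_apply, smul_eq_mul]
    rw [ENNReal.toReal_add (by finiteness) (by finiteness), ENNReal.toReal_mul,
      ENNReal.toReal_mul, ENNReal.toReal_inv, ENNReal.toReal_ofNat]
  rw [eq_add]
  rcases eq_or_ne x a with rfl | hx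
  · have : (μ[|{x}ᶜ]).real {x} = 0 := by
      rw [measureReal_def, cond_apply (measurableSet_singleton x).compl]
      simp
    rw [this]
    simp
  · have : (Measure.dirac a).real {x} = 0 := by simp [measureReal_def, hx.symm]
    rw [this]
    linarith [measureReal_le_one (μ := μ[|{a}ᶜ]) (s := {x})]

lemma integral_eq_add_integral_halfAtom (ha : μ.real {a} < 1) {g : α → ℝ} (hg : Integrable g μ) :
    ∫ x, g x ∂μ =
      (2 * μ.real {a} - 1) * g a + 2 * (1 - μ.real {a}) * ∫ x, g x ∂(halfAtom μ a) := by
  have hne : 1 - μ.real {a} ≠ 0 := by linarith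
  have hμ : μ {a}ᶜ ≠ 0 := fun h => hne <| by
    rw [← probReal_compl_eq_one_sub (measurableSet_singleton a), measureReal_def, h,
      ENNReal.toReal_zero]
  have integral_halfAtom : ∫ x, g x ∂(halfAtom μ a) =
      2⁻¹ * g a + 2⁻¹ * ((1 - μ.real {a})⁻¹ * ∫ x in {a}ᶜ, g x ∂μ) := by
    rw [halfAtom, integral_add_measure, integral_smul_measure, integral_smul_measure,
      ProbabilityTheory.cond, integral_smul_measure, integral_dirac, ENNReal.toReal_inv,
      ENNReal.toReal_inv, ← measureReal_def, probReal_compl_eq_one_sub (measurableSet_singleton a)]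
    · simp
    · exact (integrable_dirac (by simp)).smul_measure (by simp)
    · exact (hg.integrableOn.integrable.smul_measure (ENNReal.inv_ne_top.2 hμ)).smul_measure
        (by simp)
  rw [integral_halfAtom, ← integral_add_compl (measurableSet_singleton a) hg, integral_singleton,
    smul_eq_mul]
  field_simp
  ring

lemma conv_measureReal_singleton_eq_halfAtom {G : Type*} [AddCommGroup G] [MeasurableSpace G]
    [MeasurableAdd₂ G] [MeasurableSingletonClass G] (μ ν : Measure G) [IsProbabilityMeasure μ]
    [IsFiniteMeasure ν] {a : G} (ha : μ.real {a} < 1) (x : G) :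
    (μ ∗ ν).real {x} = (2 * μ.real {a} - 1) * ν.real {x - a} +
      2 * (1 - μ.real {a}) * (halfAtom μ a ∗ ν).real {x} := by
  have := isProbabilityMeasure_halfAtom μ ha
  rw [conv_measureReal_singleton, conv_measureReal_singleton,
    ← integral_eq_add_integral_halfAtom μ ha (integrable_measureReal_singleton_sub μ ν x)]

end HalfAtom

section KolmogorovRogozin

lemma inv_sqrt_add_one_le {v : ℝ} (hv : 1 ≤ v) :
    (√(v + 1))⁻¹ ≤ (1 - (4 * v)⁻¹) * (√v)⁻¹ := by
  have hinv : (4 * v)⁻¹ ≤ 1 := inv_le_one_of_one_le₀ (by linarith)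
  have sqrt_le : √v ≤ (1 - (4 * v)⁻¹) * √(v + 1) := by
    refine Real.sqrt_le_iff.2 ⟨mul_nonneg (sub_nonneg.2 hinv) (Real.sqrt_nonneg _), ?_⟩
    rw [mul_pow, Real.sq_sqrt (by linarith)]
    have key : (1 - (4 * v)⁻¹) ^ 2 * (v + 1) - v = (8 * v ^ 2 - 7 * v + 1) / (16 * v ^ 2) := by
      field_simp
      ring
    have : 0 ≤ (8 * v ^ 2 - 7 * v + 1) / (16 * v ^ 2) := div_nonneg (by nlinarith) (by positivity)
    linarith
  rwa [inv_le_iff_one_le_mul₀ (by positivity), mul_right_comm, le_mul_inv_iff₀ (by positivity),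
    one_mul]

lemma one_sub_div_mul_inv_sqrt_le {v p : ℝ} (hv : 0 < v) (hp : 0 ≤ p) (hpv : p ≤ 4 * v) :
    (1 - p / (4 * v)) * (√v)⁻¹ ≤ (√(v + p / 4))⁻¹ := by
  set e := p / (4 * v) with he
  have he0 : 0 ≤ e := by positivity
  have he1 : e ≤ 1 := (div_le_one (by positivity)).2 hpv
  have hve : v + p / 4 = v * (1 + e) := by rw [he]; field_simp
  have mul_sqrt_le_one : (1 - e) * √(1 + e) ≤ 1 := by
    refine le_of_sq_le_sq ?_ zero_le_one
    rw [mul_pow, Real.sq_sqrt (by linarith)]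
    nlinarith [mul_nonneg he0 he0]
  rw [hve, Real.sqrt_mul hv.le, mul_inv, mul_comm]
  gcongr
  rwa [← one_div, le_div_iff₀ (by positivity)]

lemma mixture_inv_sqrt_le {v κ : ℝ} (hv : 1 ≤ v) (hκ : 2⁻¹ ≤ κ) (hκ1 : κ ≤ 1) :
    (2 * κ - 1) * (2 / √v) + 2 * (1 - κ) * (2 / √(v + 1)) ≤ 2 / √(v + (1 - κ) / 2) := by
  simp only [div_eq_mul_inv (2 : ℝ)]
  calc (2 * κ - 1) * (2 * (√v)⁻¹) + 2 * (1 - κ) * (2 * (√(v + 1))⁻¹)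
      ≤ (2 * κ - 1) * (2 * (√v)⁻¹) + 2 * (1 - κ) * (2 * ((1 - (4 * v)⁻¹) * (√v)⁻¹)) := by
        gcongr
        exact inv_sqrt_add_one_le hv
    _ = 2 * ((1 - 2 * (1 - κ) / (4 * v)) * (√v)⁻¹) := by ring
    _ ≤ 2 * (√(v + 2 * (1 - κ) / 4))⁻¹ := by
        gcongr
        exact one_sub_div_mul_inv_sqrt_le (by linarith) (by linarith) (by linarith)
    _ = 2 * (√(v + (1 - κ) / 2))⁻¹ := by ring_nf

lemma measureReal_singleton_le_biggestJump (μ : Measure ℝ) [IsFiniteMeasure μ] (x : ℝ) :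
    μ.real {x} ≤ biggestJump μ :=
  le_ciSup (f := fun x : ℝ => μ.real {x})
    ⟨μ.real Set.univ, Set.forall_mem_range.2 fun _ => measureReal_mono (Set.subset_univ _)⟩ x

lemma biggestJump_nonneg (μ : Measure ℝ) : 0 ≤ biggestJump μ :=
  Real.iSup_nonneg fun _ => measureReal_nonneg

lemma exists_measureReal_singleton_eq_biggestJump (μ : Measure ℝ) [IsFiniteMeasure μ] :
    ∃ a, μ.real {a} = biggestJump μ := by
  obtain ⟨T, hT, htop⟩ := exists_finset_card_eq_forall_notMem_le (fun _ => measureReal_nonneg)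
    (summable_measureReal_singleton μ).tendsto_cofinite_zero 1
  obtain ⟨a, rfl⟩ := Finset.card_eq_one.1 hT
  refine ⟨a, (measureReal_singleton_le_biggestJump μ a).antisymm (ciSup_le fun x => ?_)⟩
  rcases eq_or_ne x a with rfl | hx
  · rfl
  · exact htop a (Finset.mem_singleton_self a) x (by simpa using hx)

/- A law with largest atom `κ ≥ 1 / 2` is, with probability `2 (1 - κ)`, replaced by a law with
atoms at most `1 / 2`, which increases the length of `L'` by one, and otherwise by a constant. -/
lemma conv_convList_measureReal_singleton_le (L L' : List (Measure ℝ))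
    (hL : ∀ μ ∈ L, IsProbabilityMeasure μ)
    (hjump : ∀ μ ∈ L, 2⁻¹ ≤ biggestJump μ ∧ biggestJump μ < 1)
    (hL' : ∀ μ ∈ L', IsProbabilityMeasure μ) (hat' : ∀ μ ∈ L', ∀ x, μ.real {x} ≤ 2⁻¹) (x : ℝ) :
    (convList L ∗ convList L').real {x} ≤
      2 / √(L'.length + 1 + (L.map fun μ => (1 - biggestJump μ) / 2).sum) := by
  induction L generalizing L' x with
  | nil =>
    have := isProbabilityMeasure_convList hL'
    rw [convList_nil, Measure.dirac_zero_conv, List.map_nil, List.sum_nil, add_zero]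
    rcases eq_or_ne L' [] with rfl | hne
    · simpa using measureReal_le_one.trans one_le_two
    · refine (convList_measureReal_singleton_le 0 hne hL' (by simpa using hat') x).trans_eq ?_
      norm_num
  | cons μ L ih =>
    rw [List.forall_mem_cons] at hL hjump
    obtain ⟨hμ, hL⟩ := hL
    obtain ⟨⟨hhalf, hlt⟩, hjump⟩ := hjump
    have := isProbabilityMeasure_convList hL
    have := isProbabilityMeasure_convList hL'
    obtain ⟨a, ha⟩ := exists_measureReal_singleton_eq_biggestJump μ
    have ha1 : μ.real {a} < 1 := ha ▸ hlt
    have := isProbabilityMeasure_halfAtom μ ha1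
    have move_halfAtom : halfAtom μ a ∗ (convList L ∗ convList L') =
        convList L ∗ convList (halfAtom μ a :: L') := by
      rw [convList_cons, ← Measure.conv_assoc, ← Measure.conv_assoc, Measure.conv_comm (convList L)]
    have halfAtom_le := ih (halfAtom μ a :: L') hL hjump (List.forall_mem_cons.2 ⟨this, hL'⟩)
      (List.forall_mem_cons.2 ⟨halfAtom_measureReal_singleton_le μ ha1, hat'⟩) x
    have dirac_le := ih L' hL hjump hL' hat' (x - a)
    rw [convList_cons, Measure.conv_assoc, conv_measureReal_singleton_eq_halfAtom μ _ ha1 x, ha,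
      move_halfAtom, List.map_cons, List.sum_cons]
    set S := (L.map fun μ => (1 - biggestJump μ) / 2).sum
    have hS : 0 ≤ S := List.sum_nonneg <| List.forall_mem_map.2 fun ν hν => by
      linarith [(hjump ν hν).2]
    simp only [List.length_cons, Nat.cast_add, Nat.cast_one] at halfAtom_le
    rw [add_right_comm _ 1 S] at halfAtom_le
    refine le_trans ?_ ((mixture_inv_sqrt_le (v := L'.length + 1 + S) ?_ hhalf hlt.le).trans_eq ?_)
    · gcongr
      linarith
    · linarith [(Nat.cast_nonneg L'.length : (0 : ℝ) ≤ _)]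
    · ring_nf

end KolmogorovRogozin

section SumsOfIndependent

variable {ι Ω : Type*} [MeasurableSpace Ω] {P : Measure Ω} {Y : ι → Ω → ℝ}

lemma measureReal_sum_eq (hY : ∀ i, Measurable (Y i)) (s : Finset ι) (x : ℝ) :
    P.real {ω | ∑ i ∈ s, Y i ω = x} = (P.map fun ω => ∑ i ∈ s, Y i ω).real {x} := by
  rw [map_measureReal_apply (Finset.measurable_sum _ fun i _ => hY i) (measurableSet_singleton x)]
  rfl

lemma map_sum_insert [DecidableEq ι] [IsFiniteMeasure P] (hY : ∀ i, Measurable (Y i))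
    (hind : iIndepFun Y P) {s : Finset ι} {i : ι} (hi : i ∉ s) :
    (P.map fun ω => ∑ j ∈ insert i s, Y j ω) =
      P.map (Y i) ∗ P.map fun ω => ∑ j ∈ s, Y j ω := by
  have indep : Y i ⟂ᵢ[P] fun ω => ∑ j ∈ s, Y j ω := by
    simpa only [← Finset.sum_apply] using (hind.indepFun_finsetSum_of_notMem hY hi).symm
  rw [← indep.map_add_eq_map_conv_map (hY i) (Finset.measurable_sum _ fun j _ => hY j)]
  simp only [Finset.sum_insert hi]
  rfl

variable [IsProbabilityMeasure P]

lemma map_sum_eq_convList (hY : ∀ i, Measurable (Y i)) (hind : iIndepFun Y P) (s : Finset ι) :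
    (P.map fun ω => ∑ i ∈ s, Y i ω) = convList (s.toList.map fun i => P.map (Y i)) := by
  classical
  have for_lists : ∀ l : List ι, l.Nodup →
      (P.map fun ω => ∑ i ∈ l.toFinset, Y i ω) = convList (l.map fun i => P.map (Y i)) := by
    intro l hl
    induction l with
    | nil => simp [convList_nil]
    | cons i l ih =>
      obtain ⟨hi, hl⟩ := List.nodup_cons.1 hl
      rw [List.toFinset_cons, map_sum_insert hY hind (by simpa using hi), ih hl, List.map_cons,
        convList_cons]
  simpa only [Finset.toList_toFinset] using for_lists s.toList s.nodup_toList

lemma isProbabilityMeasure_of_mem_map_toList (hY : ∀ i, Measurable (Y i)) (s : Finset ι) :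
    ∀ μ ∈ s.toList.map fun i => P.map (Y i), IsProbabilityMeasure μ :=
  List.forall_mem_map.2 fun i _ => Measure.isProbabilityMeasure_map (hY i).aemeasurable

lemma measureReal_sum_eq_le_of_subset (hY : ∀ i, Measurable (Y i)) (hind : iIndepFun Y P)
    {B s : Finset ι} (hB : B ⊆ s) {M : ℝ} (hM : ∀ y, P.real {ω | ∑ i ∈ B, Y i ω = y} ≤ M)
    (x : ℝ) : P.real {ω | ∑ i ∈ s, Y i ω = x} ≤ M := by
  classical
  rw [← Finset.union_eq_left.2 hB]
  clear hB
  induction s using Finset.induction generalizing x with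
  | empty => simpa only [Finset.empty_union] using hM x
  | insert i s _ ih =>
    rw [Finset.insert_union]
    by_cases hi : i ∈ s ∪ B
    · rw [Finset.insert_eq_of_mem hi]
      exact ih x
    · have := Measure.isProbabilityMeasure_map (μ := P) (hY i).aemeasurable
      rw [measureReal_sum_eq hY, map_sum_insert hY hind hi]
      refine conv_measureReal_singleton_le _ _ (fun y => ?_) x
      rw [← measureReal_sum_eq hY]
      exact ih y

lemma measureReal_sum_eq_le_biggestJump (hY : ∀ i, Measurable (Y i)) (hind : iIndepFun Y P)
    {s : Finset ι} {i : ι} (hi : i ∈ s) (x : ℝ) :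
    P.real {ω | ∑ i ∈ s, Y i ω = x} ≤ biggestJump (P.map (Y i)) := by
  have := Measure.isProbabilityMeasure_map (μ := P) (hY i).aemeasurable
  refine measureReal_sum_eq_le_of_subset hY hind (Finset.singleton_subset_iff.2 hi)
    (fun y => ?_) x
  rw [measureReal_sum_eq hY]
  simpa only [Finset.sum_singleton] using measureReal_singleton_le_biggestJump _ y

lemma measureReal_sum_eq_le_of_half_le_biggestJump (hY : ∀ i, Measurable (Y i))
    (hind : iIndepFun Y P) {s : Finset ι}
    (hjump : ∀ i ∈ s, 2⁻¹ ≤ biggestJump (P.map (Y i)) ∧ biggestJump (P.map (Y i)) < 1) (x : ℝ) :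
    P.real {ω | ∑ i ∈ s, Y i ω = x} ≤
      2 / √(1 + ∑ i ∈ s, (1 - biggestJump (P.map (Y i))) / 2) := by
  have hL := isProbabilityMeasure_of_mem_map_toList (P := P) hY s
  have := isProbabilityMeasure_convList hL
  rw [measureReal_sum_eq hY, map_sum_eq_convList hY hind]
  simpa [convList_nil, Function.comp_def] using
    conv_convList_measureReal_singleton_le _ [] hL (by simpa using hjump) (by simp) (by simp) x

lemma measureReal_sum_eq_le_of_biggestJump_le (hY : ∀ i, Measurable (Y i)) (hind : iIndepFun Y P)
    {s : Finset ι} (hs : s.Nonempty) {t : ℝ} (ht : t ≤ 2⁻¹)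
    (hjump : ∀ i ∈ s, biggestJump (P.map (Y i)) ≤ t) (x : ℝ) :
    P.real {ω | ∑ i ∈ s, Y i ω = x} ≤ 8 * t / √s.card := by
  obtain ⟨i, hi⟩ := hs
  rcases ((biggestJump_nonneg _).trans (hjump i hi)).eq_or_lt with rfl | ht0
  · simpa using (measureReal_sum_eq_le_biggestJump hY hind hi x).trans (hjump i hi)
  obtain ⟨r, hr, hr'⟩ := exists_nat_pow_near_of_lt_one (x := 2 * t) (y := (2⁻¹ : ℝ))
    (by positivity) (by linarith) (by norm_num) (by norm_num)
  have t_le : t ≤ ((2 : ℝ) ^ (r + 1))⁻¹ := by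
    rw [← inv_pow, pow_succ]
    linarith
  have le_t : ((2 : ℝ) ^ (r + 1))⁻¹ ≤ 2 * t := by rw [← inv_pow]; exact hr.le
  calc P.real {ω | ∑ i ∈ s, Y i ω = x}
      ≤ 4 * ((2 : ℝ) ^ (r + 1))⁻¹ / √(s.card + 1) := by
        rw [measureReal_sum_eq hY, map_sum_eq_convList hY hind]
        simpa using convList_measureReal_singleton_le r (by simpa using Finset.ne_empty_of_mem hi)
          (isProbabilityMeasure_of_mem_map_toList hY s) (List.forall_mem_map.2 fun j hj y => by
            have := Measure.isProbabilityMeasure_map (μ := P) (hY j).aemeasurable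
            exact (measureReal_singleton_le_biggestJump _ y).trans
              ((hjump j (Finset.mem_toList.1 hj)).trans t_le)) x
    _ ≤ 4 * (2 * t) / √s.card := by
        have : (0 : ℝ) < s.card := mod_cast Finset.card_pos.2 ⟨i, hi⟩
        gcongr
        linarith
    _ = 8 * t / √s.card := by ring

end SumsOfIndependent

section LinearBound

variable {ι : Type*} {s : Finset ι} {κ κΔ : ι → ℝ}

lemma rpow_three_halves {x : ℝ} (hx : 0 ≤ x) : x ^ (3 / 2 : ℝ) = x * √x := by
  rw [Real.sqrt_eq_rpow, ← Real.rpow_one_add' hx (by norm_num)]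
  norm_num

lemma linearBound_self_eq (h1 : ∀ i ∈ s, κ i ≤ 1) :
    linearBound s κ κ =
      (∑ i ∈ s, (1 - κ i) * κ i) / ((∑ i ∈ s, (1 - κ i)) * √(∑ i ∈ s, (1 - κ i))) := by
  rw [linearBound, rpow_three_halves (Finset.sum_nonneg fun i hi => sub_nonneg.2 (h1 i hi))]

lemma linearBound_nonneg (hle : ∀ i ∈ s, κ i ≤ κΔ i) (h0 : ∀ i ∈ s, 0 ≤ κΔ i)
    (h1 : ∀ i ∈ s, κΔ i ≤ 1) : 0 ≤ linearBound s κ κΔ :=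
  div_nonneg
    (Finset.sum_nonneg fun i hi => mul_nonneg (sub_nonneg.2 ((hle i hi).trans (h1 i hi))) (h0 i hi))
    (Real.rpow_nonneg (Finset.sum_nonneg fun i hi => sub_nonneg.2 (h1 i hi)) _)

lemma linearBound_self_le (hs : s.Nonempty) (h0 : ∀ i ∈ s, 0 ≤ κ i)
    (hle : ∀ i ∈ s, κ i ≤ κΔ i) (hlt : ∀ i ∈ s, κΔ i < 1) :
    linearBound s κ κ ≤ linearBound s κ κΔ := by
  have denom_pos : 0 < ∑ i ∈ s, (1 - κΔ i) :=
    Finset.sum_pos (fun i hi => sub_pos.2 (hlt i hi)) hs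
  have hκ : ∀ i ∈ s, 0 ≤ 1 - κ i := fun i hi => sub_nonneg.2 ((hle i hi).trans (hlt i hi).le)
  unfold linearBound
  gcongr with i hi i hi
  · exact Finset.sum_nonneg fun i hi => mul_nonneg (hκ i hi) ((h0 i hi).trans (hle i hi))
  · exact hκ i hi
  · exact hle i hi
  · exact hle i hi

lemma half_card_le_card_filter_le_two_mul_average (h0 : ∀ i ∈ s, 0 ≤ κ i) :
    (s.card : ℝ) / 2 ≤ (s.filter fun i => κ i ≤ 2 * (∑ j ∈ s, κ j) / s.card).card := by
  set K := ∑ j ∈ s, κ j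
  rcases s.eq_empty_or_nonempty with rfl | hs
  · simp
  have card_pos : (0 : ℝ) < s.card := mod_cast hs.card_pos
  set B := s.filter fun i => ¬ κ i ≤ 2 * K / s.card
  have hB : (B.card : ℝ) ≤ s.card / 2 := by
    by_contra! h
    have : K < K := calc
      K ≤ (s.card / 2 : ℝ) * (2 * K / s.card) := by field_simp; rfl
      _ ≤ B.card * (2 * K / s.card) := by
          have : 0 ≤ K := Finset.sum_nonneg h0
          gcongr
      _ < ∑ i ∈ B, κ i := by
          have B_card_pos : (0 : ℝ) < B.card := by linarith
          rw [← nsmul_eq_mul, ← Finset.sum_const]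
          exact Finset.sum_lt_sum_of_nonempty (Finset.card_pos.1 (by exact_mod_cast B_card_pos))
            fun i hi => not_le.1 (Finset.mem_filter.1 hi).2
      _ ≤ K := Finset.sum_le_sum_of_subset_of_nonneg (Finset.filter_subset _ _)
          fun i hi _ => h0 i hi
    exact this.false
  have card_add : ((s.filter fun i => κ i ≤ 2 * K / s.card).card : ℝ) + B.card = s.card := by
    exact_mod_cast Finset.card_filter_add_card_filter_not _
  linarith

lemma two_div_sqrt_le_linearBound {A : Finset ι} (hA : A ⊆ s) (h0 : ∀ i ∈ s, 0 ≤ κ i)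
    (h1 : ∀ i ∈ s, κ i ≤ 1) (hpos : 0 < ∑ i ∈ s, (1 - κ i)) (hκ : ∀ i ∈ A, 2⁻¹ ≤ κ i)
    (hW : (∑ i ∈ s, (1 - κ i)) / 2 ≤ ∑ i ∈ A, (1 - κ i)) :
    2 / √(1 + ∑ i ∈ A, (1 - κ i) / 2) ≤ 16 * linearBound s κ κ := by
  rw [linearBound_self_eq h1, ← Finset.sum_div]
  set W := ∑ i ∈ s, (1 - κ i)
  have le_numerator : W / 4 ≤ ∑ i ∈ s, (1 - κ i) * κ i := calc
    W / 4 ≤ ∑ i ∈ A, (1 - κ i) * 2⁻¹ := by rw [← Finset.sum_mul]; linarith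
    _ ≤ ∑ i ∈ A, (1 - κ i) * κ i := Finset.sum_le_sum fun i hi =>
        mul_le_mul_of_nonneg_left (hκ i hi) (sub_nonneg.2 (h1 i (hA hi)))
    _ ≤ _ := Finset.sum_le_sum_of_subset_of_nonneg hA fun i hi _ =>
        mul_nonneg (sub_nonneg.2 (h1 i hi)) (h0 i hi)
  have sqrt_le : √W / 2 ≤ √(1 + (∑ i ∈ A, (1 - κ i)) / 2) := by
    refine Real.le_sqrt_of_sq_le ?_
    rw [div_pow, Real.sq_sqrt hpos.le]
    linarith
  calc 2 / √(1 + (∑ i ∈ A, (1 - κ i)) / 2) ≤ 2 / (√W / 2) := by gcongr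
    _ = 16 * ((W / 4) / (W * √W)) := by field_simp; norm_num
    _ ≤ _ := by gcongr

lemma sum_div_card_mul_sqrt_le_linearBound {B : Finset ι} (hB : B ⊆ s) (hne : B.Nonempty)
    (h0 : ∀ i ∈ s, 0 ≤ κ i) (h1 : ∀ i ∈ s, κ i ≤ 1) (hκ : ∀ i ∈ B, κ i ≤ 2⁻¹)
    (hW : (∑ i ∈ s, (1 - κ i)) / 2 ≤ ∑ i ∈ B, (1 - κ i)) :
    16 * (∑ i ∈ B, κ i) / (B.card * √(B.card / 2)) ≤ 128 * linearBound s κ κ := by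
  rw [linearBound_self_eq h1]
  set W := ∑ i ∈ s, (1 - κ i)
  set K := ∑ i ∈ B, κ i
  have hK : 0 ≤ K := Finset.sum_nonneg fun i hi => h0 i (hB hi)
  have le_numerator : K / 2 ≤ ∑ i ∈ s, (1 - κ i) * κ i := calc
    K / 2 = ∑ i ∈ B, 2⁻¹ * κ i := by rw [← Finset.mul_sum]; ring
    _ ≤ ∑ i ∈ B, (1 - κ i) * κ i := Finset.sum_le_sum fun i hi =>
        mul_le_mul_of_nonneg_right (by linarith [hκ i hi]) (h0 i (hB hi))
    _ ≤ _ := Finset.sum_le_sum_of_subset_of_nonneg hB fun i hi _ =>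
        mul_nonneg (sub_nonneg.2 (h1 i hi)) (h0 i hi)
  have W_pos : 0 < W := calc
    0 < ∑ i ∈ B, (1 - κ i) := Finset.sum_pos (fun i hi => by linarith [hκ i hi]) hne
    _ ≤ W := Finset.sum_le_sum_of_subset_of_nonneg hB fun i hi _ => sub_nonneg.2 (h1 i hi)
  have W_le : W ≤ 2 * B.card := by
    have : ∑ i ∈ B, (1 - κ i) = B.card - K := by simp [K]
    linarith
  have sqrt_W_le : √W ≤ 2 * √(B.card / 2) := by
    refine Real.sqrt_le_iff.2 ⟨by positivity, ?_⟩
    rw [mul_pow, Real.sq_sqrt (by positivity)]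
    linarith
  calc 16 * K / (B.card * √(B.card / 2))
      = 128 * ((K / 2) / (2 * B.card * (2 * √(B.card / 2)))) := by ring
    _ ≤ _ := by
        gcongr
        exact (by positivity : 0 ≤ K / 2).trans le_numerator

end LinearBound

section Kesten

variable {ι Ω : Type*} [MeasurableSpace Ω] {P : Measure Ω} [IsProbabilityMeasure P]
  {Y : ι → Ω → ℝ}

lemma measureReal_sum_eq_le_sum_biggestJump (hY : ∀ i, Measurable (Y i)) (hind : iIndepFun Y P)
    {s : Finset ι} (hs : s.Nonempty) (hjump : ∀ i ∈ s, biggestJump (P.map (Y i)) ≤ 2⁻¹) (x : ℝ) :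
    P.real {ω | ∑ i ∈ s, Y i ω = x} ≤
      16 * (∑ i ∈ s, biggestJump (P.map (Y i))) / (s.card * √(s.card / 2)) := by
  set K := ∑ i ∈ s, biggestJump (P.map (Y i))
  have card_pos : (0 : ℝ) < s.card := mod_cast hs.card_pos
  have hK : 0 ≤ K := Finset.sum_nonneg fun _ _ => biggestJump_nonneg _
  set B := s.filter fun i => biggestJump (P.map (Y i)) ≤ 2 * K / s.card
  have half_card_le : (s.card : ℝ) / 2 ≤ B.card :=
    half_card_le_card_filter_le_two_mul_average fun _ _ => biggestJump_nonneg _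
  have hB : B.Nonempty := Finset.card_pos.1 <| by
    have : (0 : ℝ) < B.card := by linarith
    exact_mod_cast this
  calc P.real {ω | ∑ i ∈ s, Y i ω = x}
      ≤ 8 * min (2 * K / s.card) 2⁻¹ / √B.card :=
        measureReal_sum_eq_le_of_subset hY hind (Finset.filter_subset _ _)
          (measureReal_sum_eq_le_of_biggestJump_le hY hind hB (min_le_right _ _) fun i hi =>
            le_min (Finset.mem_filter.1 hi).2 (hjump i (Finset.filter_subset _ _ hi))) x
    _ ≤ 8 * (2 * K / s.card) / √(s.card / 2) := by
        gcongr
        exact min_le_left _ _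
    _ = 16 * K / (s.card * √(s.card / 2)) := by
        ring

theorem measureReal_sum_eq_le_linearBound (hY : ∀ i, Measurable (Y i)) (hind : iIndepFun Y P)
    {s : Finset ι} (hs : s.Nonempty) (hlt : ∀ i ∈ s, biggestJump (P.map (Y i)) < 1) (x : ℝ) :
    P.real {ω | ∑ i ∈ s, Y i ω = x} ≤
      128 * linearBound s (fun i => biggestJump (P.map (Y i)))
        fun i => biggestJump (P.map (Y i)) := by
  set κ := fun i => biggestJump (P.map (Y i))
  have h0 : ∀ i ∈ s, 0 ≤ κ i := fun i _ => biggestJump_nonneg _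
  have h1 : ∀ i ∈ s, κ i ≤ 1 := fun i hi => (hlt i hi).le
  have W_pos : 0 < ∑ i ∈ s, (1 - κ i) := Finset.sum_pos (fun i hi => sub_pos.2 (hlt i hi)) hs
  set A := s.filter fun i => 2⁻¹ ≤ κ i
  set B := s.filter fun i => ¬ 2⁻¹ ≤ κ i
  have hA : A ⊆ s := Finset.filter_subset _ _
  have hB : B ⊆ s := Finset.filter_subset _ _
  have half_le : ∀ i ∈ A, 2⁻¹ ≤ κ i := fun i hi => (Finset.mem_filter.1 hi).2
  have le_half : ∀ i ∈ B, κ i ≤ 2⁻¹ := fun i hi => (not_le.1 (Finset.mem_filter.1 hi).2).le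
  have split : ∑ i ∈ A, (1 - κ i) + ∑ i ∈ B, (1 - κ i) = ∑ i ∈ s, (1 - κ i) :=
    Finset.sum_filter_add_sum_filter_not s _ _
  rcases le_total (∑ i ∈ B, (1 - κ i)) (∑ i ∈ A, (1 - κ i)) with hle | hle
  · have nonneg := linearBound_nonneg (fun i _ => le_refl (κ i)) h0 h1
    calc P.real {ω | ∑ i ∈ s, Y i ω = x} ≤ 2 / √(1 + ∑ i ∈ A, (1 - κ i) / 2) :=
          measureReal_sum_eq_le_of_subset hY hind hA
            (measureReal_sum_eq_le_of_half_le_biggestJump hY hind fun i hi =>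
              ⟨half_le i hi, hlt i (hA hi)⟩) x
      _ ≤ 16 * linearBound s κ κ :=
          two_div_sqrt_le_linearBound hA h0 h1 W_pos half_le (by linarith)
      _ ≤ 128 * linearBound s κ κ := by linarith
  · have B_nonempty : B.Nonempty := by
      by_contra h
      rw [Finset.not_nonempty_iff_eq_empty.1 h, Finset.sum_empty] at hle split
      linarith
    calc P.real {ω | ∑ i ∈ s, Y i ω = x} ≤ 16 * (∑ i ∈ B, κ i) / (B.card * √(B.card / 2)) :=
          measureReal_sum_eq_le_of_subset hY hind hB
            (measureReal_sum_eq_le_sum_biggestJump hY hind B_nonempty le_half) x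
      _ ≤ 128 * linearBound s κ κ :=
          sum_div_card_mul_sqrt_le_linearBound hB B_nonempty h0 h1 le_half (by linarith)

end Kesten

section LinearForms

lemma map_const_mul_measureReal_singleton (μ : Measure ℝ) {b : ℝ} (hb : b ≠ 0) (x : ℝ) :
    (μ.map (b * ·)).real {x} = μ.real {x / b} := by
  rw [map_measureReal_apply (by fun_prop) (measurableSet_singleton x)]
  congr 1
  ext t
  simp only [Set.mem_preimage, Set.mem_singleton_iff, eq_div_iff hb, mul_comm b]

lemma biggestJump_map_const_mul (μ : Measure ℝ) {b : ℝ} (hb : b ≠ 0) :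
    biggestJump (μ.map (b * ·)) = biggestJump μ := by
  simp only [biggestJump, map_const_mul_measureReal_singleton μ hb]
  exact (Equiv.divRight₀ b hb).iSup_comp (g := fun x => μ.real {x})

variable {ι Ω : Type*} [MeasurableSpace Ω] {P : Measure Ω} [IsProbabilityMeasure P]
  {X : ι → Ω → ℝ}

lemma measureReal_linearForm_eq_le (hX : ∀ i, Measurable (X i)) (hind : iIndepFun X P)
    {s : Finset ι} (hs : s.Nonempty) {κΔ : ι → ℝ}
    (hκ : ∀ i ∈ s, biggestJump (P.map (X i)) ≤ κΔ i) (hlt : ∀ i ∈ s, κΔ i < 1) {b : ι → ℝ}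
    (hb : ∀ i ∈ s, b i ≠ 0) (x : ℝ) :
    P.real {ω | ∑ i ∈ s, b i * X i ω = x} ≤
      128 * linearBound s (fun i => biggestJump (P.map (X i))) κΔ := by
  have jump_eq : ∀ i ∈ s, biggestJump (P.map fun ω => b i * X i ω) = biggestJump (P.map (X i)) :=
    fun i hi => by
      rw [← biggestJump_map_const_mul (P.map (X i)) (hb i hi),
        Measure.map_map (by fun_prop) (hX i)]
      rfl
  have kesten := measureReal_sum_eq_le_linearBound (Y := fun i ω => b i * X i ω)
    (fun i => (hX i).const_mul (b i)) (hind.comp (fun i => (b i * ·)) fun i => by fun_prop) hs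
    (fun i hi => (jump_eq i hi).trans_lt ((hκ i hi).trans_lt (hlt i hi))) x
  have bound_eq : linearBound s (fun i => biggestJump (P.map fun ω => b i * X i ω))
      (fun i => biggestJump (P.map fun ω => b i * X i ω)) =
      linearBound s (fun i => biggestJump (P.map (X i))) fun i => biggestJump (P.map (X i)) := by
    unfold linearBound
    congr 1
    · exact Finset.sum_congr rfl fun i hi => by simp only [jump_eq i hi]
    · exact congrArg (· ^ (3 / 2 : ℝ)) <| Finset.sum_congr rfl fun i hi => by
        simp only [jump_eq i hi]
  rw [bound_eq] at kesten
  refine kesten.trans ?_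
  gcongr
  exact linearBound_self_le hs (fun _ _ => biggestJump_nonneg _) hκ hlt

end LinearForms

section Decoupling

variable {α β : Type*} [MeasurableSpace α] [MeasurableSpace β] (μ : Measure α) (ν : Measure β)
  [IsProbabilityMeasure μ] [IsProbabilityMeasure ν]

lemma sq_measureReal_prod_le {E : Set (α × β)} (hE : MeasurableSet E) :
    (μ.prod ν).real E ^ 2 ≤
      (μ.prod (ν.prod ν)).real {q | (q.1, q.2.1) ∈ E ∧ (q.1, q.2.2) ∈ E} := by
  set section_prob : α → ℝ := fun a => ν.real (Prod.mk a ⁻¹' E)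
  have memLp : MemLp section_prob 2 μ :=
    .of_bound (measurable_measure_prodMk_left hE).ennreal_toReal.aestronglyMeasurable 1 <|
      ae_of_all _ fun a => by
        rw [Real.norm_of_nonneg measureReal_nonneg]
        exact measureReal_le_one
  have hE₂ : MeasurableSet {q : α × β × β | (q.1, q.2.1) ∈ E ∧ (q.1, q.2.2) ∈ E} :=
    (hE.preimage (by fun_prop : Measurable fun q : α × β × β => (q.1, q.2.1))).inter
      (hE.preimage (by fun_prop : Measurable fun q : α × β × β => (q.1, q.2.2)))
  have section_sq (a : α) : (ν.prod ν).real
      (Prod.mk a ⁻¹' {q : α × β × β | (q.1, q.2.1) ∈ E ∧ (q.1, q.2.2) ∈ E}) =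
      section_prob a ^ 2 := by
    rw [sq, ← measureReal_prod_prod]
    rfl
  calc (μ.prod ν).real E ^ 2 = (∫ a, section_prob a ∂μ) ^ 2 := by
        rw [measureReal_prod_eq_integral _ _ hE]
    _ ≤ ∫ a, section_prob a ^ 2 ∂μ := by
        have := variance_nonneg section_prob μ
        rw [variance_eq_sub memLp] at this
        exact sub_nonneg.1 this
    _ = _ := by
        rw [measureReal_prod_eq_integral _ _ hE₂]
        exact integral_congr_ae (ae_of_all _ fun a => (section_sq a).symm)

lemma measureReal_prod_le_of_section_le {F : Set (α × β)} (hF : MeasurableSet F) {G : Set β}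
    {M : ℝ} (hM : 0 ≤ M) (hsection : ∀ y ∉ G, μ.real {a | (a, y) ∈ F} ≤ M) :
    (μ.prod ν).real F ≤ ν.real G + M := by
  have fst_prob : (μ.prod ν).real F = ∫ y, μ.real {a | (a, y) ∈ F} ∂ν := by
    rw [← Measure.prod_swap, map_measureReal_apply measurable_swap hF,
      measureReal_prod_eq_integral _ _ (measurable_swap hF)]
    rfl
  have integrable_section : Integrable (fun y => μ.real {a | (a, y) ∈ F}) ν :=
    .of_bound (measurable_measure_prodMk_right hF).ennreal_toReal.aestronglyMeasurable 1 <|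
      ae_of_all _ fun y => by
        rw [Real.norm_of_nonneg measureReal_nonneg]
        exact measureReal_le_one
  set G' := toMeasurable ν G
  have hG' : MeasurableSet G' := measurableSet_toMeasurable ν G
  have integrable_indicator : Integrable (G'.indicator fun _ => (1 : ℝ)) ν :=
    (integrable_const _).indicator hG'
  calc (μ.prod ν).real F = ∫ y, μ.real {a | (a, y) ∈ F} ∂ν := fst_prob
    _ ≤ ∫ y, (G'.indicator (fun _ => (1 : ℝ)) y + M) ∂ν := by
        refine integral_mono integrable_section (integrable_indicator.add (integrable_const _))
          fun y => ?_
        by_cases hy : y ∈ G'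
        · simpa only [Set.indicator_of_mem hy] using measureReal_le_one.trans (by linarith)
        · simpa only [Set.indicator_of_notMem hy, zero_add] using
            hsection y fun h => hy (subset_toMeasurable ν G h)
    _ = ν.real G + M := by
        rw [integral_add integrable_indicator (integrable_const _),
          integral_indicator_const _ hG', measureReal_def, measure_toMeasurable]
        simp [measureReal_def]

end Decoupling

section Markov

lemma measureReal_half_card_le_card_filter_le {ι Ω : Type*} [MeasurableSpace Ω] (P : Measure Ω)
    [IsFiniteMeasure P] {s : Finset ι} (hs : s.Nonempty) {E : ι → Set Ω}
    [∀ ω, DecidablePred fun j => ω ∈ E j] (hE : ∀ j, MeasurableSet (E j)) :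
    P.real {ω | (s.card : ℝ) / 2 ≤ (s.filter fun j => ω ∈ E j).card} ≤
      2 * (1 / s.card * ∑ j ∈ s, P.real (E j)) := by
  have : (0 : ℝ) < s.card := mod_cast hs.card_pos
  have integrable_indicator (j) : Integrable ((E j).indicator fun _ => (1 : ℝ)) P :=
    (integrable_const _).indicator (hE j)
  have card_eq (ω : Ω) : ((s.filter fun j => ω ∈ E j).card : ℝ) =
      ∑ j ∈ s, (E j).indicator (fun _ => 1) ω := by
    simp only [Set.indicator_apply, Finset.sum_boole]
  have markov : (s.card : ℝ) / 2 * P.real {ω | (s.card : ℝ) / 2 ≤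
      ∑ j ∈ s, (E j).indicator (fun _ => 1) ω} ≤ ∑ j ∈ s, P.real (E j) := calc
    _ ≤ ∫ ω, ∑ j ∈ s, (E j).indicator (fun _ => (1 : ℝ)) ω ∂P :=
        mul_meas_ge_le_integral_of_nonneg
          (ae_of_all _ fun ω => Finset.sum_nonneg fun j _ =>
            Set.indicator_nonneg (fun _ _ => zero_le_one) _)
          (integrable_finsetSum _ fun j _ => integrable_indicator j) _
    _ = ∑ j ∈ s, P.real (E j) := by
        rw [integral_finsetSum _ fun j _ => integrable_indicator j]
        simp only [integral_indicator_const _ (hE _), smul_eq_mul, mul_one]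
  simp only [card_eq]
  calc _ ≤ (∑ j ∈ s, P.real (E j)) / (s.card / 2) :=
        (le_div_iff₀' (by positivity)).2 markov
    _ = _ := by field_simp

end Markov

section QuadraticForms

variable {ι : Type*}

/-- The quadratic form `∑ c i j * z i * z j` restricted to the block of indices `S`. -/
def blockForm (c : ι → ι → ℝ) (S : Finset ι) (z : ι → ℝ) : ℝ :=
  ∑ i ∈ S, ∑ j ∈ S, c i j * z i * z j

/-- The `j`-th coefficient of the linear form `w ↦ ∑ j, (∑ i ∈ S, c i j * z i) * w j` into which
a bilinear form turns when its first argument is fixed to `z` on `S`. -/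
def mixedCoeff (c : ι → ι → ℝ) (S : Finset ι) (z : ι → ℝ) (j : ι) : ℝ :=
  ∑ i ∈ S, c i j * z i

variable (c : ι → ι → ℝ) {S S₁ S₂ : Finset ι} {z w : ι → ℝ}

@[fun_prop]
lemma measurable_blockForm : Measurable (blockForm c S) := by
  unfold blockForm
  fun_prop

@[fun_prop]
lemma measurable_mixedCoeff (j : ι) : Measurable fun z => mixedCoeff c S z j := by
  unfold mixedCoeff
  fun_prop

lemma blockForm_congr (h : ∀ i ∈ S, z i = w i) : blockForm c S z = blockForm c S w :=
  Finset.sum_congr rfl fun i hi => Finset.sum_congr rfl fun j hj => by rw [h i hi, h j hj]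

lemma mixedCoeff_congr (h : ∀ i ∈ S, z i = w i) : mixedCoeff c S z = mixedCoeff c S w :=
  funext fun _ => Finset.sum_congr rfl fun i hi => by rw [h i hi]

lemma mixedCoeff_sub : mixedCoeff c S (z - w) = mixedCoeff c S z - mixedCoeff c S w := by
  ext j
  simp only [mixedCoeff, Pi.sub_apply, mul_sub, Finset.sum_sub_distrib]

lemma mixedCoeff_eq_sum_filter (z : ι → ℝ) (j : ι) :
    mixedCoeff c S z j = ∑ i ∈ S.filter fun i => c i j ≠ 0, c i j * z i :=
  (Finset.sum_filter_of_ne fun _ _ => left_ne_zero_of_mul).symm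

variable {c} [DecidableEq ι]

lemma blockForm_union (hc : ∀ i j, c i j = c j i) (hd : Disjoint S₁ S₂) (z : ι → ℝ) :
    blockForm c (S₁ ∪ S₂) z =
      blockForm c S₁ z + blockForm c S₂ z + ∑ j ∈ S₂, 2 * mixedCoeff c S₁ z j * z j := by
  have mixed : ∑ j ∈ S₂, mixedCoeff c S₁ z j * z j =
      ∑ i ∈ S₂, ∑ j ∈ S₁, c i j * z i * z j := by
    refine Finset.sum_congr rfl fun j _ => ?_
    rw [mixedCoeff, Finset.sum_mul]
    exact Finset.sum_congr rfl fun i _ => by rw [hc i j]; ring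
  have mixed_comm : ∑ j ∈ S₂, mixedCoeff c S₁ z j * z j =
      ∑ i ∈ S₁, ∑ j ∈ S₂, c i j * z i * z j := by
    simp only [mixedCoeff, Finset.sum_mul]
    exact Finset.sum_comm
  simp only [blockForm, Finset.sum_union hd, Finset.sum_add_distrib, mul_assoc (2 : ℝ),
    ← Finset.mul_sum]
  linarith

lemma blockForm_union_piecewise (hc : ∀ i j, c i j = c j i) (hd : Disjoint S₁ S₂)
    (z w : ι → ℝ) :
    blockForm c (S₁ ∪ S₂) (S₁.piecewise z w) =
      blockForm c S₁ z + blockForm c S₂ w + ∑ j ∈ S₂, 2 * mixedCoeff c S₁ z j * w j := by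
  have eq_left : ∀ i ∈ S₁, S₁.piecewise z w i = z i := fun i hi => S₁.piecewise_eq_of_mem z w hi
  have eq_right : ∀ i ∈ S₂, S₁.piecewise z w i = w i := fun i hi =>
    S₁.piecewise_eq_of_notMem z w (Finset.disjoint_right.1 hd hi)
  rw [blockForm_union hc hd, blockForm_congr c eq_left, blockForm_congr c eq_right,
    mixedCoeff_congr c eq_left]
  congr 1
  exact Finset.sum_congr rfl fun j hj => by rw [eq_right j hj]

lemma sum_mixedCoeff_sub_eq (hc : ∀ i j, c i j = c j i) (hd : Disjoint S₁ S₂)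
    {z z' w : ι → ℝ} (h : blockForm c (S₁ ∪ S₂) (S₁.piecewise z w) =
      blockForm c (S₁ ∪ S₂) (S₁.piecewise z' w)) :
    ∑ j ∈ S₂, 2 * mixedCoeff c S₁ (z - z') j * w j = blockForm c S₁ z' - blockForm c S₁ z := by
  rw [blockForm_union_piecewise hc hd, blockForm_union_piecewise hc hd] at h
  simp only [mixedCoeff_sub, Pi.sub_apply, mul_sub, sub_mul, Finset.sum_sub_distrib]
  linarith

end QuadraticForms

section Resampling

variable {ι : Type*} [DecidableEq ι] {E : ι → Type*} [∀ i, MeasurableSpace (E i)]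

lemma measurable_piecewise (S : Finset ι) :
    Measurable fun p : (∀ i, E i) × (∀ i, E i) => S.piecewise p.2 p.1 := by
  refine measurable_pi_lambda _ fun i => ?_
  by_cases h : i ∈ S
  · simp only [S.piecewise_eq_of_mem _ _ h]
    fun_prop
  · simp only [S.piecewise_eq_of_notMem _ _ h]
    fun_prop

lemma measurePreserving_piecewise [Fintype ι] (S : Finset ι) (μ : ∀ i, Measure (E i))
    [∀ i, IsProbabilityMeasure (μ i)] :
    MeasurePreserving (fun p : (∀ i, E i) × (∀ i, E i) => S.piecewise p.2 p.1)
      ((Measure.pi μ).prod (Measure.pi μ)) (Measure.pi μ) := by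
  refine ⟨measurable_piecewise S, (Measure.pi_eq fun s hs => ?_).symm⟩
  have preimage_eq : (fun p : (∀ i, E i) × (∀ i, E i) => S.piecewise p.2 p.1) ⁻¹'
      Set.univ.pi s = (Set.univ.pi (S.piecewise (fun _ => Set.univ) s)) ×ˢ
        (Set.univ.pi (S.piecewise s fun _ => Set.univ)) := by
    ext p
    simp only [Set.mem_preimage, Set.mem_pi, Set.mem_univ, true_imp_iff, Set.mem_prod,
      ← forall_and]
    refine forall_congr' fun i => ?_
    by_cases h : i ∈ S <;> simp [h]
  rw [Measure.map_apply (measurable_piecewise S) (MeasurableSet.univ_pi hs), preimage_eq,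
    Measure.prod_prod, Measure.pi_pi, Measure.pi_pi, ← Finset.prod_mul_distrib]
  refine Finset.prod_congr rfl fun i _ => ?_
  by_cases h : i ∈ S <;> simp [h]

end Resampling

section QuadraticConcentration

variable {ι : Type*} [Fintype ι] (μ : ι → Measure ℝ) [∀ i, IsProbabilityMeasure (μ i)]
  {c : ι → ι → ℝ} {S S₁ S₂ : Finset ι} {κΔ κbarΔ : ι → ℝ}

lemma measureReal_mixedCoeff_sub_eq_zero_le
    (hκ : ∀ i ∈ S, biggestJump (symmetrizedLaw (μ i)) ≤ κbarΔ i) (hlt : ∀ i ∈ S, κbarΔ i < 1)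
    {j : ι} (hN : (S.filter fun i => c i j ≠ 0).Nonempty) :
    ((Measure.pi μ).prod (Measure.pi μ)).real {y | mixedCoeff c S (y.1 - y.2) j = 0} ≤
      128 * linearBound (S.filter fun i => c i j ≠ 0)
        (fun i => biggestJump (symmetrizedLaw (μ i))) κbarΔ := by
  have hmp := measurePreserving_arrowProdEquivProdArrow ℝ ℝ ι μ μ
  set N := S.filter fun i => c i j ≠ 0
  set P := Measure.pi fun i => (μ i).prod (μ i)
  have hN_mem : ∀ i ∈ N, i ∈ S ∧ c i j ≠ 0 := fun i => Finset.mem_filter.1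
  have law (i : ι) : P.map (fun v => (v i).1 - (v i).2) = symmetrizedLaw (μ i) := calc
    _ = (P.map fun v => v i).map fun p => p.1 - p.2 :=
        (Measure.map_map (by fun_prop) (by fun_prop)).symm
    _ = _ := congrArg _ (measurePreserving_eval (fun i => (μ i).prod (μ i)) i).map_eq
  have hind : iIndepFun (fun i (v : ι → ℝ × ℝ) => (v i).1 - (v i).2) P :=
    iIndepFun_pi (X := fun _ (p : ℝ × ℝ) => p.1 - p.2) fun _ => by fun_prop
  have bound := measureReal_linearForm_eq_le (fun i => by fun_prop) hind hN (κΔ := κbarΔ)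
    (fun i hi => by rw [law]; exact hκ i (hN_mem i hi).1) (fun i hi => hlt i (hN_mem i hi).1)
    (b := fun i => c i j) (fun i hi => (hN_mem i hi).2) 0
  simp only [law] at bound
  rw [← hmp.map_eq, map_measureReal_apply hmp.measurable
    (measurableSet_eq_fun (by fun_prop) measurable_const)]
  simp only [mixedCoeff_eq_sum_filter]
  exact bound

lemma measureReal_linearForm_eq_le_iSup (hκ : ∀ j ∈ S, biggestJump (μ j) ≤ κΔ j)
    (hlt : ∀ j ∈ S, κΔ j < 1) (hS : S.Nonempty) {b : ι → ℝ}
    (hcard : (S.card : ℝ) / 2 ≤ (S.filter fun j => b j ≠ 0).card) (x : ℝ) :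
    (Measure.pi μ).real {w | ∑ j ∈ S, b j * w j = x} ≤
      128 * ⨆ D : {D : Finset ι // D ⊆ S ∧ (S.card : ℝ) / 2 ≤ (D.card : ℝ)},
        linearBound D.1 (fun j => biggestJump (μ j)) κΔ := by
  set D := S.filter fun j => b j ≠ 0
  have hD : D ⊆ S := Finset.filter_subset _ _
  have D_nonempty : D.Nonempty := by
    have : (0 : ℝ) < D.card :=
      (half_pos (Nat.cast_pos.2 hS.card_pos)).trans_le hcard
    exact Finset.card_pos.1 (mod_cast this)
  have law (j : ι) : (Measure.pi μ).map (fun w => w j) = μ j := (measurePreserving_eval μ j).map_eq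
  have bound := measureReal_linearForm_eq_le (fun j => by fun_prop)
    (iIndepFun_pi (μ := μ) (X := fun _ t => t) fun _ => by fun_prop) D_nonempty (κΔ := κΔ)
    (fun j hj => by rw [law]; exact hκ j (hD hj)) (fun j hj => hlt j (hD hj))
    (b := b) (fun j hj => (Finset.mem_filter.1 hj).2) x
  simp only [law] at bound
  have sum_eq (w : ι → ℝ) : ∑ j ∈ S, b j * w j = ∑ j ∈ D, b j * w j :=
    (Finset.sum_filter_of_ne fun _ _ => left_ne_zero_of_mul).symm
  simp only [sum_eq]
  refine bound.trans ?_
  gcongr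
  exact le_ciSup (f := fun D : {D : Finset ι // D ⊆ S ∧ (S.card : ℝ) / 2 ≤ (D.card : ℝ)} =>
    linearBound D.1 (fun j => biggestJump (μ j)) κΔ) (Set.finite_range _).bddAbove ⟨D, hD, hcard⟩

lemma sq_measureReal_blockForm_eq_le [DecidableEq ι] (hc : ∀ i j, c i j = c j i)
    (hd : Disjoint S₁ S₂) (x : ℝ) :
    (Measure.pi μ).real {z | blockForm c (S₁ ∪ S₂) z = x} ^ 2 ≤
      ((Measure.pi μ).prod ((Measure.pi μ).prod (Measure.pi μ))).real
        {q | ∑ j ∈ S₂, 2 * mixedCoeff c S₁ (q.2.1 - q.2.2) j * q.1 j =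
          blockForm c S₁ q.2.2 - blockForm c S₁ q.2.1} := by
  have hmp := measurePreserving_piecewise S₁ μ
  have hlevel : MeasurableSet {z | blockForm c (S₁ ∪ S₂) z = x} :=
    measurableSet_eq_fun (by fun_prop) measurable_const
  calc (Measure.pi μ).real {z | blockForm c (S₁ ∪ S₂) z = x} ^ 2
      = ((Measure.pi μ).prod (Measure.pi μ)).real
          {p | blockForm c (S₁ ∪ S₂) (S₁.piecewise p.2 p.1) = x} ^ 2 := by
        conv_lhs => rw [← hmp.map_eq, map_measureReal_apply hmp.measurable hlevel]
        rfl
    _ ≤ _ := sq_measureReal_prod_le _ _ (hlevel.preimage hmp.measurable)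
    _ ≤ _ := measureReal_mono fun q hq => sum_mixedCoeff_sub_eq hc hd (hq.1.trans hq.2.symm)

lemma measureReal_half_card_le_card_vanishing_mixedCoeff_le
    (hκ : ∀ i ∈ S₁, biggestJump (symmetrizedLaw (μ i)) ≤ κbarΔ i) (hlt : ∀ i ∈ S₁, κbarΔ i < 1)
    (hS₂ : S₂.Nonempty) (hN : ∀ j ∈ S₂, (S₁.filter fun i => c i j ≠ 0).Nonempty) :
    ((Measure.pi μ).prod (Measure.pi μ)).real {y | (S₂.card : ℝ) / 2 ≤
        (S₂.filter fun j => mixedCoeff c S₁ (y.1 - y.2) j = 0).card} ≤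
      256 * (1 / S₂.card * ∑ j ∈ S₂, linearBound (S₁.filter fun i => c i j ≠ 0)
        (fun i => biggestJump (symmetrizedLaw (μ i))) κbarΔ) := by
  have markov := measureReal_half_card_le_card_filter_le
    ((Measure.pi μ).prod (Measure.pi μ)) hS₂
    (E := fun j => {y | mixedCoeff c S₁ (y.1 - y.2) j = 0})
    fun j => measurableSet_eq_fun (by fun_prop) measurable_const
  calc _ ≤ _ := markov
    _ ≤ 2 * (1 / S₂.card * ∑ j ∈ S₂, 128 * linearBound (S₁.filter fun i => c i j ≠ 0)
          (fun i => biggestJump (symmetrizedLaw (μ i))) κbarΔ) := by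
        gcongr with j hj
        exact measureReal_mixedCoeff_sub_eq_zero_le μ hκ hlt (hN j hj)
    _ = _ := by
        rw [← Finset.mul_sum]
        ring

theorem sq_measureReal_blockForm_eq_le_linearBound [DecidableEq ι] (hc : ∀ i j, c i j = c j i)
    (hd : Disjoint S₁ S₂) (hS₂ : S₂.Nonempty)
    (hN : ∀ j ∈ S₂, (S₁.filter fun i => c i j ≠ 0).Nonempty)
    (hκ : ∀ j ∈ S₂, biggestJump (μ j) ≤ κΔ j) (hlt : ∀ j ∈ S₂, κΔ j < 1)
    (hκbar : ∀ i ∈ S₁, biggestJump (symmetrizedLaw (μ i)) ≤ κbarΔ i)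
    (hltbar : ∀ i ∈ S₁, κbarΔ i < 1) (x : ℝ) :
    (Measure.pi μ).real {z | blockForm c (S₁ ∪ S₂) z = x} ^ 2 ≤
      256 * ((1 / (S₂.card : ℝ)) *
          ∑ j ∈ S₂, linearBound (S₁.filter fun i => c i j ≠ 0)
            (fun i => biggestJump (symmetrizedLaw (μ i))) κbarΔ
        + ⨆ D : {D : Finset ι // D ⊆ S₂ ∧ (S₂.card : ℝ) / 2 ≤ (D.card : ℝ)},
            linearBound D.1 (fun j => biggestJump (μ j)) κΔ) := by
  set sup := ⨆ D : {D : Finset ι // D ⊆ S₂ ∧ (S₂.card : ℝ) / 2 ≤ (D.card : ℝ)},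
    linearBound D.1 (fun j => biggestJump (μ j)) κΔ
  have sup_nonneg : 0 ≤ sup := Real.iSup_nonneg fun D =>
    linearBound_nonneg (fun j hj => hκ j (D.2.1 hj))
      (fun j hj => (biggestJump_nonneg _).trans (hκ j (D.2.1 hj))) fun j hj => (hlt j (D.2.1 hj)).le
  set manyVanish : Set ((ι → ℝ) × (ι → ℝ)) := {y | (S₂.card : ℝ) / 2 ≤
    (S₂.filter fun j => mixedCoeff c S₁ (y.1 - y.2) j = 0).card}
  have section_le : ∀ y ∉ manyVanish, (Measure.pi μ).real
      {w | ∑ j ∈ S₂, 2 * mixedCoeff c S₁ (y.1 - y.2) j * w j =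
        blockForm c S₁ y.2 - blockForm c S₁ y.1} ≤ 128 * sup := by
    intro y hy
    refine measureReal_linearForm_eq_le_iSup μ hκ hlt hS₂ ?_ _
    have card_add : ((S₂.filter fun j => mixedCoeff c S₁ (y.1 - y.2) j = 0).card : ℝ) +
        (S₂.filter fun j => mixedCoeff c S₁ (y.1 - y.2) j ≠ 0).card = S₂.card := by
      exact_mod_cast Finset.card_filter_add_card_filter_not _
    have few_vanish : ((S₂.filter fun j => mixedCoeff c S₁ (y.1 - y.2) j = 0).card : ℝ) <
        S₂.card / 2 := not_le.1 hy
    simp only [ne_eq, mul_eq_zero, OfNat.ofNat_ne_zero, false_or]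
    linarith
  calc _ ≤ _ := sq_measureReal_blockForm_eq_le μ hc hd x
    _ ≤ _ := measureReal_prod_le_of_section_le _ _
        (measurableSet_eq_fun (by fun_prop) (by fun_prop)) (by positivity) section_le
    _ ≤ _ := by
        linarith [measureReal_half_card_le_card_vanishing_mixedCoeff_le μ hκbar hltbar hS₂ hN]

end QuadraticConcentration

lemma biggestJump_le_of_isJumpLevel {μ : Measure ℝ} {k : ℝ} (h : IsJumpLevel μ k) :
    biggestJump μ ≤ k := by
  obtain ⟨-, x, Δ, -, hΔ, -, rfl⟩ := h
  unfold jumpLevel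
  split_ifs <;> linarith

theorem mainTheorem3_general {ι Ω : Type*} [Fintype ι] [DecidableEq ι] [MeasurableSpace Ω]
    {P : Measure Ω} [IsProbabilityMeasure P] {ξ : ι → Ω → ℝ} {c : ι → ι → ℝ} {S₁ S₂ : Finset ι}
    {κΔ κbarΔ : ι → ℝ} (hξ : ∀ i, Measurable (ξ i)) (hind : iIndepFun ξ P)
    (hc : ∀ i j, c i j = c j i) (hd : Disjoint S₁ S₂) (hu : S₁ ∪ S₂ = Finset.univ)
    (hS₂ : S₂.Nonempty) (hN : ∀ j ∈ S₂, (S₁.filter fun i => c i j ≠ 0).Nonempty)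
    (hκ : ∀ j ∈ S₂, biggestJump (P.map (ξ j)) ≤ κΔ j) (hlt : ∀ j ∈ S₂, κΔ j < 1)
    (hκbar : ∀ i ∈ S₁, biggestJump (symmetrizedLaw (P.map (ξ i))) ≤ κbarΔ i)
    (hltbar : ∀ i ∈ S₁, κbarΔ i < 1) (x : ℝ) :
    P.real {ω | ∑ i, ∑ j, c i j * ξ i ω * ξ j ω = x} ≤
      16 * √((1 / (S₂.card : ℝ)) *
            ∑ j ∈ S₂, linearBound (S₁.filter fun i => c i j ≠ 0)
              (fun i => biggestJump (symmetrizedLaw (P.map (ξ i)))) κbarΔ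
          + ⨆ D : {D : Finset ι // D ⊆ S₂ ∧ (S₂.card : ℝ) / 2 ≤ (D.card : ℝ)},
              linearBound D.1 (fun j => biggestJump (P.map (ξ j))) κΔ) := by
  have (i : ι) : IsProbabilityMeasure (P.map (ξ i)) :=
    Measure.isProbabilityMeasure_map (hξ i).aemeasurable
  have prob_eq : P.real {ω | ∑ i, ∑ j, c i j * ξ i ω * ξ j ω = x} =
      (Measure.pi fun i => P.map (ξ i)).real {z | blockForm c (S₁ ∪ S₂) z = x} := by
    rw [← hind.map_fun_eq_pi_map fun i => (hξ i).aemeasurable, hu,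
      map_measureReal_apply (measurable_pi_lambda _ hξ)
        (measurableSet_eq_fun (by fun_prop) measurable_const)]
    rfl
  rw [prob_eq, show (16 : ℝ) = √256 by norm_num, ← Real.sqrt_mul (by norm_num)]
  exact Real.le_sqrt_of_sq_le <|
    sq_measureReal_blockForm_eq_le_linearBound _ hc hd hS₂ hN hκ hlt hκbar hltbar x

theorem mainTheorem3 :
    ∃ C : ℝ, 0 < C ∧
      ∀ (n : ℕ) (Ω : Type*) [MeasurableSpace Ω] (P : Measure Ω) [IsProbabilityMeasure P]
        (ξ : Fin n → Ω → ℝ) (c : Fin n → Fin n → ℝ) (S₁ S₂ : Finset (Fin n))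
        (κΔ κbarΔ : Fin n → ℝ),
        (∀ i, Measurable (ξ i)) →
        iIndepFun ξ P →
        (∀ i, IsNondegenerate P (ξ i)) →
        (∀ i j, c i j = c j i) →
        Disjoint S₁ S₂ → S₁ ∪ S₂ = Finset.univ → S₂.Nonempty →
        (∀ j ∈ S₂, (nbhd c S₁ j).Nonempty) →
        (∀ i, IsJumpLevel (P.map (ξ i)) (κΔ i)) →
        (∀ i, IsJumpLevel (symmetrizedLaw (P.map (ξ i))) (κbarΔ i)) →
        ∀ x : ℝ,
          P.real {ω | ∑ i, ∑ j, c i j * ξ i ω * ξ j ω = x} ≤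
            C * √((1 / (S₂.card : ℝ)) *
                  ∑ j ∈ S₂, linearBound (nbhd c S₁ j)
                    (fun i => biggestJump (symmetrizedLaw (P.map (ξ i)))) κbarΔ
                + ⨆ D : {D : Finset (Fin n) // D ⊆ S₂ ∧ (S₂.card : ℝ) / 2 ≤ (D.card : ℝ)},
                    linearBound D.1 (fun j => biggestJump (P.map (ξ j))) κΔ) := by
  exact ⟨16, by norm_num, fun _ _ _ _ _ _ _ _ _ _ _ hξ hind _ hc hd hu hS₂ hN hκ hκbar x =>
    mainTheorem3_general hξ hind hc hd hu hS₂ hN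
      (fun j _ => biggestJump_le_of_isJumpLevel (hκ j)) (fun j _ => (hκ j).1)
      (fun i _ => biggestJump_le_of_isJumpLevel (hκbar i)) (fun i _ => (hκbar i).1) x⟩
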